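/- Let $m,n\ge 0$ be integers with $N=m+n\ge 1$, let $\mathbf s=(s_i)_{i\in\mathbb Z}$ be a sequence of signs $s_i\in\{1,-1\}$ with $s_{i+N}=s_i$ and exactly $m$ of $s_1,\dots,s_N$ equal to $1$, and let $k\in\mathbb Z$. *Layers.* A layer (an $\mathbf s$-partition with corner colour $k$) is a pair $(\lambda,\mu)$ of weakly decreasing sequences $\lambda_1\ge\lambda_2\ge\cdots$, $\mu_1\ge\mu_2\ge\cdots$ of non-negative integers with finitely many non-zero terms, such that $\mu_j=0$ whenever $\lambda_j=0$; $\lambda_j=\lambda_{j+1}$ only if $s_{k+\lambda_j}=s_k$ or $\lambda_j=\mu_j=0$; and $\mu_j=\mu_{j+1}$ only if $s_{k-\mu_j}=s_k$ or $\mu_j=\lambda_{j+1}=0$. Let $\ell$ denote the number of non-zero terms. Write $(\lambda,\mu)\ge_k(\lambda',\mu')$ if $\ell(\lambda')\le\ell(\mu)$, $\ell(\lambda')\le\ell(\lambda)$, $\ell(\mu')\le\ell(\mu)$; for $1\le i\le\ell(\lambda')$, $\lambda_i\ge\lambda'_i$, with equality only if $s_{k+\lambda_i}=-s_k$ or $\lambda_i=0$;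 and for $1\le i\le\ell(\mu')$, $\mu_i\ge\mu'_i$, with equality only if $s_{k-\mu_i}=-s_k$ or $\mu_i=0$. *Plane $\mathbf s$-partitions.* A plane $\mathbf s$-partition with corner colour $k$ is a sequence of layers $(\lambda^{(a)},\mu^{(a)})$, $a\ge 1$, almost all equal to $(\emptyset,\emptyset)$, with $(\lambda^{(a)},\mu^{(a)})\ge_k(\lambda^{(a+1)},\mu^{(a+1)})$ for all $a$. Each part $\lambda^{(a)}_j$ contributes boxes of colours $k,k+1,\dots,k+\lambda^{(a)}_j-1$ and each part $\mu^{(a)}_j$ contributes boxes of colours $k-1,k-2,\dots,k-\mu^{(a)}_j$ (colours modulo $N$). Its degree is $(l_0,\dots,l_{N-1})$, where $l_i$ is the number of its boxes of colour $i$. *The MacMahon module.* The MacMahon module $\mathcal M_k$ is, as a graded space, the complex vector space whose basis is the set of plane $\mathbf s$-partitions with corner colour $k$, each basis vector having its degree just defined (when $m\ne n$ and $N\ge 3$ this is the graded space underlying the module of the quantum toroidal $\mathfrak{gl}_{m|n}$ superalgebra of parity $\mathbf s$). Its character is $\chi(\mathcal M_k)=\sum_{l}\dim\big((\mathcal M_k)_l\big)\,z_0^{l_0}\cdots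 z_{N-1}^{l_{N-1}}$. For $i\le j$ put $z_{i,j}=z_iz_{i+1}\cdots z_j$ with $z_{t+N}=z_t$, and $\sigma(i,j)=(-1)^{|i|+|i+1|+\cdots+|j|}$ with $|t|=(1-s_ts_{t+1})/2$. **Theorem.** All graded components $(\mathcal M_k)_l$ are finite-dimensional, there are finitely many plane $\mathbf s$-partitions with corner colour $k$ of each degree, and the character of $\mathcal M_k$, i.e. the generating function of these plane $\mathbf s$-partitions, is $$\chi(\mathcal M_k)=\prod_{i\le k}\ \prod_{j\ge k}\bigl(1-\sigma(i,j)\,z_{i,j}\bigr)^{-\sigma(i,j)}$$ as formal power series in $z_0,\dots,z_{N-1}$ over $\mathbb Z$; the product over all pairs $(i,j)$ converges unconditionally, coefficientwise. -/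

import Mathlib

open scoped MvPowerSeries.WithPiTopology

/-- A parity sequence of type `m|n`: an `(m+n)`-periodic sequence of signs indexed by `ℤ`
with exactly `m` signs `+1` among `s 1, …, s (m+n)`. -/
structure ParitySequence (m n : ℕ) where
  sign : ℤ → ℤˣ
  periodic : ∀ i : ℤ, sign (i + ((m + n : ℕ) : ℤ)) = sign i
  card_pos : ((Finset.Icc (1 : ℤ) ((m + n : ℕ) : ℤ)).filter (fun i => sign i = 1)).card = m

namespace ParitySequence

variable {m n : ℕ}

/-- The parity `|i| = (1 - s i * s (i+1)) / 2` of the node (simple root) `i`; it is `0` or `1`. -/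
def nodeParity (s : ParitySequence m n) (i : ℤ) : ℤ :=
  (1 - (s.sign i : ℤ) * (s.sign (i + 1) : ℤ)) / 2

/-- The sign `σ(i,j) = (-1)^(|i| + |i+1| + ⋯ + |j|)`. -/
noncomputable def sigma (s : ParitySequence m n) (i j : ℤ) : ℤˣ :=
  (-1 : ℤˣ) ^ (∑ t ∈ Finset.Icc i j, s.nodeParity t)

end ParitySequence

/-- A basis label of one layer of the MacMahon module with highest box of color `k` (a basis label
of the Fock module of highest weight `-s k • Λ_k`): a pair of partitions `(λ, μ)` in Frobenius-type
coordinates, `λ = arm` and `μ = leg`, rows and columns being numbered from `0`. -/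
@[ext]
structure SPartition {m n : ℕ} (s : ParitySequence m n) (k : ℤ) where
  arm : ℕ →₀ ℕ
  leg : ℕ →₀ ℕ
  arm_anti : ∀ j, arm (j + 1) ≤ arm j
  arm_repeat : ∀ j, arm j = arm (j + 1) →
    s.sign (k + arm j) = s.sign k ∨ (arm j = 0 ∧ leg j = 0)
  leg_anti : ∀ j, leg (j + 1) ≤ leg j
  leg_repeat : ∀ j, leg j = leg (j + 1) →
    s.sign (k - leg j) = s.sign k ∨ (leg j = 0 ∧ arm (j + 1) = 0)
  leg_eq_zero : ∀ j, arm j = 0 → leg j = 0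

namespace SPartition

variable {m n : ℕ} {s : ParitySequence m n} {k : ℤ}

/-- The number of nonzero parts of `λ`. -/
def armLength (a : SPartition s k) : ℕ := a.arm.support.card

/-- The number of nonzero parts of `μ`. -/
def legLength (a : SPartition s k) : ℕ := a.leg.support.card

/-- The relation `(λ¹, μ¹) ≥_k (λ², μ²)`, which says that the layer `b` may be put on top of the
layer `a`. -/
structure Dominates (a b : SPartition s k) : Prop where
  length_arm_leg : b.armLength ≤ a.legLength
  length_arm_arm : b.armLength ≤ a.armLength
  length_leg_leg : b.legLength ≤ a.legLength
  arm_le : ∀ i < b.armLength, b.arm i ≤ a.arm i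
  arm_eq : ∀ i < b.armLength, a.arm i = b.arm i →
    s.sign (k + a.arm i) = -s.sign k ∨ a.arm i = 0
  leg_le : ∀ i < b.legLength, b.leg i ≤ a.leg i
  leg_eq : ∀ i < b.legLength, a.leg i = b.leg i →
    s.sign (k - a.leg i) = -s.sign k ∨ a.leg i = 0

/-- The empty layer `(∅, ∅)`. -/
def IsEmptyLayer (a : SPartition s k) : Prop := a.arm = 0 ∧ a.leg = 0

end SPartition

/-- A plane `s`-partition whose box `(0,0,0)` has color `k`: a sequence of layers, from bottom to
top, almost all empty, each of which dominates the next one. -/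
@[ext]
structure PlaneSPartition {m n : ℕ} (s : ParitySequence m n) (k : ℤ) where
  layer : ℕ → SPartition s k
  dominates : ∀ a, (layer a).Dominates (layer (a + 1))
  finite : {a | ¬ (layer a).IsEmptyLayer}.Finite

namespace PlaneSPartition

variable {m n : ℕ} {s : ParitySequence m n} {k : ℤ}

/-- The boxes `(i, j, a)` of a plane `s`-partition. In layer `a` the part `λ_j` is the row of
boxes `(j, j), (j+1, j), …, (j+λ_j-1, j)` and the part `μ_i` is the column of boxes
`(i, i+1), …, (i, i+μ_i)`. -/
def boxes (P : PlaneSPartition s k) : Set (ℕ × ℕ × ℕ) :=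
  {b | (b.2.1 ≤ b.1 ∧ b.1 < b.2.1 + (P.layer b.2.2).arm b.2.1) ∨
       (b.1 < b.2.1 ∧ b.2.1 ≤ b.1 + (P.layer b.2.2).leg b.1)}

/-- The color of the box `(i, j, a)` is `i - j + k` modulo `m + n`. -/
def color (m n : ℕ) (k : ℤ) (b : ℕ × ℕ × ℕ) : ZMod (m + n) :=
  (((b.1 : ℤ) - (b.2.1 : ℤ) + k : ℤ) : ZMod (m + n))

/-- The degree of a plane `s`-partition: its number of boxes of each color. (The set of boxes is
finite, so `Set.ncard` is the true number.) -/
noncomputable def degree [NeZero (m + n)] (P : PlaneSPartition s k) : ZMod (m + n) →₀ ℕ :=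
  Finsupp.equivFunOnFinite.symm (fun c => {b ∈ P.boxes | color m n k b = c}.ncard)

end PlaneSPartition

/-- The underlying space of the MacMahon module `M_k`: the complex vector space with basis the
plane `s`-partitions whose box `(0,0,0)` has color `k`. -/
abbrev MacMahonModule {m n : ℕ} (s : ParitySequence m n) (k : ℤ) : Type :=
  PlaneSPartition s k →₀ ℂ

/-- The homogeneous component of degree `l` of the MacMahon module. The creation operator `F_i`
adds a box of color `i` and has degree `1_i`, and the empty plane `s`-partition (the highest weight
vector) has degree `0`, so each basis vector is homogeneous, of degree its number of boxes of each
color; there is nothing in degrees with a negative entry. -/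
noncomputable def MacMahonModule.component {m n : ℕ} [NeZero (m + n)] (s : ParitySequence m n)
    (k : ℤ) (l : ZMod (m + n) →₀ ℕ) : Submodule ℂ (MacMahonModule s k) :=
  Submodule.span ℂ
    ((fun P : PlaneSPartition s k => (Finsupp.single P 1 : MacMahonModule s k)) ''
      {P | P.degree = l})

/-- The character `∑_l dim (V_l) z^l` of a graded vector space `V = ⨁_l V_l`. -/
noncomputable def gradedCharacter {ι V : Type*} [AddCommGroup V] [Module ℂ V]
    (comp : (ι →₀ ℕ) → Submodule ℂ V) : MvPowerSeries ι ℤ :=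
  fun l => (Module.finrank ℂ (comp l) : ℤ)

/-- The generating function of plane `s`-partitions whose box `(0,0,0)` has color `k`. -/
noncomputable def PlaneSPartition.generatingFunction {m n : ℕ} [NeZero (m + n)]
    (s : ParitySequence m n) (k : ℤ) : MvPowerSeries (ZMod (m + n)) ℤ :=
  fun l => ({P : PlaneSPartition s k | P.degree = l}.ncard : ℤ)

/-- The monomial `z_{i,j} = z_i z_{i+1} ⋯ z_j`, where `z_{t+m+n} = z_t`. -/
noncomputable def zInterval (m n : ℕ) (i j : ℤ) : MvPowerSeries (ZMod (m + n)) ℤ :=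
  ∏ t ∈ Finset.Icc i j, MvPowerSeries.X (t : ZMod (m + n))

/-- The power series `(1 - σ(i,j) z_{i,j})^(-σ(i,j))`, for `i ≤ j`. -/
noncomputable def rootFactor {m n : ℕ} (s : ParitySequence m n) (i j : ℤ) :
    MvPowerSeries (ZMod (m + n)) ℤ :=
  if s.sigma i j = 1 then
    Ring.inverse (1 - (((s.sigma i j : ℤˣ) : ℤ) : MvPowerSeries (ZMod (m + n)) ℤ) * zInterval m n i j)
  else
    1 - (((s.sigma i j : ℤˣ) : ℤ) : MvPowerSeries (ZMod (m + n)) ℤ) * zInterval m n i j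

/-! Regard the part `λ_j` of layer `a` as a pile of boxes over the cell `(j, a)`, and the part `μ_j`
likewise. Cutting along the diagonals `i - j = const` gives Young diagrams in the variables `(j,
a)`, which decrease on both sides of the main slice. Two adjacent cells have equal height exactly
when they leave the sequence of slices at the same step. The sign conditions on equal neighbouring
parts therefore say that each step removes a vertical strip if the sign at that step equals `s_k`,
and a horizontal strip otherwise (`isStrip_iff_of_height`). A plane `s`-partition is thus a pair of
strip chains descending to the empty diagram from a common diagram (`equivStripChains`).

Colour is constant on each slice, so Abel summation turns the degree into a sum of weights of the
removed strips: a cell removed at a given step accounts for a whole row of boxes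
(`degree_eq_chainWeight`). The generating function of pairs of chains is a supersymmetric Cauchy
sum, with one factor for each pair formed by a left and a right step: `1/(1 - z)` if the two strip
types agree and `1 + z` if they differ (`hasGeneratingFunction_stripChain_pair`). It comes from a
bijective growth rule (`exists_localRule`) which exchanges adding one strip with removing another,
at the cost of a multiplicity; iterating it moves every left step past every right step. Since
`σ(i,j)` telescopes to `s_i s_{j+1}`, these factors are the root factors
(`rootFactor_eq_stripFactor`).

The Cauchy identity is used for finitely many steps only. Each part is at most the total degree
(`arm_le_degree_and_leg_le_degree`), so a coefficient in total degree `d` sees only finitely many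
factors, while the others are `1` up to degree `d`. This yields both the finiteness and the
unconditional convergence. -/

/-! ### Strips, row lengths, and the growth rule for two horizontal strips. -/

namespace YoungDiagram

/-- `κ.IsStrip b ν` says that `ν / κ` is a vertical strip if `b = true`, and a horizontal strip if
`b = false`. -/
def IsStrip : Bool → YoungDiagram → YoungDiagram → Prop
  | true, κ, ν => κ ≤ ν ∧ ∀ i j, (i, j + 1) ∈ ν → (i, j) ∈ κ
  | false, κ, ν => κ ≤ ν ∧ ∀ i j, (i + 1, j) ∈ ν → (i, j) ∈ κ

theorem IsStrip.le {b : Bool} {κ ν : YoungDiagram} (h : IsStrip b κ ν) : κ ≤ ν := by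
  cases b <;> exact h.1

theorem ext_rowLen {μ ν : YoungDiagram} (h : ∀ i, μ.rowLen i = ν.rowLen i) : μ = ν := by
  ext ⟨i, j⟩
  rw [mem_cells, mem_cells, mem_iff_lt_rowLen, mem_iff_lt_rowLen, h]

theorem le_iff_rowLen {μ ν : YoungDiagram} : μ ≤ ν ↔ ∀ i, μ.rowLen i ≤ ν.rowLen i := by
  constructor
  · intro h i
    by_contra hlt
    have h1 : (i, ν.rowLen i) ∈ μ := mem_iff_lt_rowLen.2 (not_le.1 hlt)
    exact lt_irrefl _ (mem_iff_lt_rowLen.1 (h h1))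
  · rintro h ⟨i, j⟩ hc
    exact mem_iff_lt_rowLen.2 ((mem_iff_lt_rowLen.1 hc).trans_le (h i))

theorem isStrip_true_iff {κ ν : YoungDiagram} :
    IsStrip true κ ν ↔ ∀ i, κ.rowLen i ≤ ν.rowLen i ∧ ν.rowLen i ≤ κ.rowLen i + 1 := by
  simp only [IsStrip, le_iff_rowLen, mem_iff_lt_rowLen, forall_and]
  refine and_congr_right fun _ => forall_congr' fun i => ⟨fun h => ?_, fun h j hj => by omega⟩
  by_contra hlt
  exact lt_irrefl _ (h (κ.rowLen i) (by omega))

theorem isStrip_false_iff {κ ν : YoungDiagram} :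
    IsStrip false κ ν ↔ ∀ i, κ.rowLen i ≤ ν.rowLen i ∧ ν.rowLen (i + 1) ≤ κ.rowLen i := by
  simp only [IsStrip, le_iff_rowLen, mem_iff_lt_rowLen, forall_and]
  refine and_congr_right fun _ => forall_congr' fun i => ⟨fun h => ?_, fun h j hj => by omega⟩
  by_contra hlt
  exact lt_irrefl _ (h (κ.rowLen i) (by omega))

theorem exists_rowLen_eq_zero (μ : YoungDiagram) : ∃ M, ∀ i, M ≤ i → μ.rowLen i = 0 := by
  refine ⟨μ.colLen 0, fun i hi => ?_⟩
  by_contra h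
  have h1 : (i, 0) ∈ μ := mem_iff_lt_rowLen.2 (Nat.pos_of_ne_zero h)
  exact absurd (mem_iff_lt_colLen.1 h1) (not_lt.2 hi)

/-- The Young diagram with row lengths `f 0 ≥ f 1 ≥ ⋯`. -/
def ofRows (f : ℕ → ℕ) (hf : ∀ i, f (i + 1) ≤ f i) (M : ℕ) : YoungDiagram where
  cells := (Finset.range M ×ˢ Finset.range (f 0)).filter fun c => c.2 < f c.1
  isLowerSet := by
    rintro ⟨i, j⟩ ⟨i', j'⟩ ⟨hi : i' ≤ i, hj : j' ≤ j⟩ h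
    have hanti : Antitone f := antitone_nat_of_succ_le hf
    simp only [Finset.coe_filter, Finset.mem_product, Finset.mem_range, Set.mem_ofPred_eq] at h ⊢
    have := hanti hi
    omega

theorem rowLen_ofRows {f : ℕ → ℕ} {hf : ∀ i, f (i + 1) ≤ f i} {M : ℕ} (hM : f M = 0) (i : ℕ) :
    (ofRows f hf M).rowLen i = f i := by
  have hanti : Antitone f := antitone_nat_of_succ_le hf
  have key : ∀ j, j < (ofRows f hf M).rowLen i ↔ j < f i := by
    intro j
    rw [← mem_iff_lt_rowLen, ← mem_cells]
    simp only [ofRows, Finset.mem_filter, Finset.mem_product, Finset.mem_range]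
    refine ⟨fun h => h.2, fun h => ⟨⟨?_, h.trans_le (hanti (Nat.zero_le i))⟩, h⟩⟩
    by_contra hi
    have := hanti (not_lt.1 hi)
    omega
  exact le_antisymm (not_lt.1 fun h => lt_irrefl _ ((key _).1 h))
    (not_lt.1 fun h => lt_irrefl _ ((key _).2 h))

theorem card_eq_sum_rowLen {μ : YoungDiagram} {M : ℕ} (hM : ∀ i, M ≤ i → μ.rowLen i = 0) :
    μ.card = ∑ i ∈ Finset.range M, μ.rowLen i := by
  have h := Finset.card_eq_sum_card_fiberwise (s := μ.cells) (t := Finset.range M)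
    (f := Prod.fst) (by
      rintro ⟨i, j⟩ h
      have h1 := mem_iff_lt_rowLen.1 ((mem_cells _).1 h)
      simp only [Finset.coe_range, Set.mem_Iio]
      by_contra hi
      rw [hM i (not_lt.1 hi)] at h1
      omega)
  rw [YoungDiagram.card, h]
  refine Finset.sum_congr rfl fun i _ => ?_
  rw [rowLen_eq_card]
  rfl

/-- Conservation of the number of cells under a row-by-row rule with carry `c`. -/
theorem card_add_card_of_carry {κ μ ν ρ : YoungDiagram} (c : ℕ → ℕ)
    (h : ∀ i, ν.rowLen i + ρ.rowLen i + c (i + 1) = κ.rowLen i + μ.rowLen i + c i)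
    (hc : ∃ M, ∀ i, M ≤ i → c i = 0) :
    ν.card + ρ.card = κ.card + μ.card + c 0 := by
  obtain ⟨M₁, h₁⟩ := κ.exists_rowLen_eq_zero
  obtain ⟨M₂, h₂⟩ := μ.exists_rowLen_eq_zero
  obtain ⟨M₃, h₃⟩ := ν.exists_rowLen_eq_zero
  obtain ⟨M₄, h₄⟩ := ρ.exists_rowLen_eq_zero
  obtain ⟨M₅, h₅⟩ := hc
  have hsum : ∀ M, ∑ i ∈ Finset.range M, ν.rowLen i + ∑ i ∈ Finset.range M, ρ.rowLen i + c M =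
      ∑ i ∈ Finset.range M, κ.rowLen i + ∑ i ∈ Finset.range M, μ.rowLen i + c 0 := by
    intro M
    induction M with
    | zero => simp
    | succ M ih =>
      simp only [Finset.sum_range_succ]
      have := h M
      omega
  have hM := hsum (M₁ + M₂ + M₃ + M₄ + M₅)
  rw [← card_eq_sum_rowLen fun i hi => h₁ i (by omega),
    ← card_eq_sum_rowLen fun i hi => h₂ i (by omega),
    ← card_eq_sum_rowLen fun i hi => h₃ i (by omega),
    ← card_eq_sum_rowLen fun i hi => h₄ i (by omega), h₅ _ (by omega)] at hM
  omega

/-- The row lengths produced by the local rule for two horizontal strips. -/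
def rowInsert (κ μ ρ : YoungDiagram) (n : ℕ) : ℕ → ℕ
  | 0 => max (κ.rowLen 0) (μ.rowLen 0) + n
  | i + 1 => max (κ.rowLen (i + 1)) (μ.rowLen (i + 1)) +
      (min (κ.rowLen i) (μ.rowLen i) - ρ.rowLen i)

/-- The row lengths of the diagram removed by the local rule for two horizontal strips. -/
def rowDelete (κ μ ν : YoungDiagram) (i : ℕ) : ℕ :=
  min (κ.rowLen i) (μ.rowLen i) + max (κ.rowLen (i + 1)) (μ.rowLen (i + 1)) - ν.rowLen (i + 1)

/-- The entries `ν_{i+1}` and `ρ_i` range over the same interval, from `max κ_{i+1} μ_{i+1}` to `min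
κ_i μ_i`, and reflecting this interval exchanges them. Only `ν_0` has no upper bound; its excess
over `max κ_0 μ_0` is the multiplicity. -/
theorem exists_localRule_false_false (κ μ : YoungDiagram) :
    ∃ e : {ν // IsStrip false κ ν ∧ IsStrip false μ ν} ≃
        ℕ × {ρ // IsStrip false ρ κ ∧ IsStrip false ρ μ},
      ∀ ν, ν.1.card + (e ν).2.1.card = κ.card + μ.card + (e ν).1 := by
  obtain ⟨M₁, h₁⟩ := κ.exists_rowLen_eq_zero
  obtain ⟨M₂, h₂⟩ := μ.exists_rowLen_eq_zero
  have hκ : ∀ i, κ.rowLen (i + 1) ≤ κ.rowLen i := fun i => κ.rowLen_anti _ _ (Nat.le_succ i)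
  have hμ : ∀ i, μ.rowLen (i + 1) ≤ μ.rowLen i := fun i => μ.rowLen_anti _ _ (Nat.le_succ i)
  have hA : ∀ ν : YoungDiagram, IsStrip false κ ν ∧ IsStrip false μ ν →
      ∀ i, rowDelete κ μ ν (i + 1) ≤ rowDelete κ μ ν i := by
    rintro ν ⟨h, h'⟩ i
    rw [isStrip_false_iff] at h h'
    have := h i; have := h' i; have := h (i + 1); have := h' (i + 1)
    have := h (i + 1 + 1); have := h' (i + 1 + 1)
    simp only [rowDelete]
    omega
  have hB : ∀ (n : ℕ) (ρ : YoungDiagram), IsStrip false ρ κ ∧ IsStrip false ρ μ →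
      ∀ i, rowInsert κ μ ρ n (i + 1) ≤ rowInsert κ μ ρ n i := by
    rintro n ρ ⟨h, h'⟩ i
    rw [isStrip_false_iff] at h h'
    have := h i; have := h' i
    cases i with
    | zero => simp only [rowInsert]; omega
    | succ i =>
      have := h (i + 1); have := h' (i + 1)
      simp only [rowInsert]; omega
  have h3 : ∀ ν : YoungDiagram, rowDelete κ μ ν (M₁ + M₂) = 0 := by
    intro ν
    rw [rowDelete, h₁ (M₁ + M₂) (by omega), h₁ (M₁ + M₂ + 1) (by omega), h₂ (M₁ + M₂ + 1) (by omega)]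
    simp
  have h4 : ∀ (n : ℕ) (ρ : YoungDiagram), rowInsert κ μ ρ n (M₁ + M₂ + 1) = 0 := by
    intro n ρ
    simp only [rowInsert]
    rw [h₁ (M₁ + M₂) (by omega), h₁ (M₁ + M₂ + 1) (by omega), h₂ (M₁ + M₂ + 1) (by omega)]
    simp
  refine ⟨⟨fun ν => (ν.1.rowLen 0 - max (κ.rowLen 0) (μ.rowLen 0),
      ⟨ofRows (rowDelete κ μ ν.1) (hA ν.1 ν.2) (M₁ + M₂), ?_⟩),
    fun p => ⟨ofRows _ (hB p.1 p.2.1 p.2.2) (M₁ + M₂ + 1), ?_⟩, ?_, ?_⟩, ?_⟩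
  · obtain ⟨ν, h, h'⟩ := ν
    rw [isStrip_false_iff] at h h'
    simp only [isStrip_false_iff, rowLen_ofRows (h3 ν), rowDelete]
    constructor <;> intro i <;> have := h i <;> have := h' i <;> have := h (i + 1) <;>
      have := h' (i + 1) <;> omega
  · obtain ⟨n, ρ, h, h'⟩ := p
    rw [isStrip_false_iff] at h h'
    simp only [isStrip_false_iff, rowLen_ofRows (h4 n ρ)]
    constructor <;> intro i <;> cases i <;> simp only [rowInsert] <;>
      grind
  · rintro ⟨ν, h, h'⟩
    have h₀ := isStrip_false_iff.1 h
    have h₀' := isStrip_false_iff.1 h'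
    apply Subtype.ext
    apply ext_rowLen
    intro i
    simp only [rowLen_ofRows (h4 _ _)]
    cases i with
    | zero =>
      have := h₀ 0; have := h₀' 0
      simp only [rowInsert]; omega
    | succ i =>
      have := h₀ i; have := h₀' i; have := h₀ (i + 1); have := h₀' (i + 1)
      simp only [rowInsert, rowLen_ofRows (h3 ν), rowDelete]; omega
  · rintro ⟨n, ρ, h, h'⟩
    refine Prod.ext ?_ (Subtype.ext (ext_rowLen fun i => ?_))
    · simp only [rowLen_ofRows (h4 _ _), rowInsert]; omega
    · have := isStrip_false_iff.1 h i; have := isStrip_false_iff.1 h' i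
      simp only [rowLen_ofRows (h3 _), rowDelete]
      simp only [rowLen_ofRows (h4 _ _), rowInsert]; omega
  · rintro ⟨ν, h, h'⟩
    refine card_add_card_of_carry
      (fun i => ν.rowLen i - max (κ.rowLen i) (μ.rowLen i)) (fun i => ?_) ?_
    · have := isStrip_false_iff.1 h i; have := isStrip_false_iff.1 h' i; have := isStrip_false_iff.1 h (i + 1); have := isStrip_false_iff.1 h' (i + 1)
      simp only [Equiv.coe_fn_mk, rowLen_ofRows (h3 ν), rowDelete]; omega
    · obtain ⟨M, hM⟩ := ν.exists_rowLen_eq_zero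
      exact ⟨M, fun i hi => by simp [hM i hi]⟩

end YoungDiagram

/-! ### The growth rule for strips of different types, and the general rule. -/

namespace YoungDiagram

/-- The recursion refers to larger indices, but it stops at the next index where `a` holds. It
recovers carries when the growth rule is run backwards. -/
theorem exists_lookahead {a : ℕ → Prop} [DecidablePred a] (ha : ∀ i, ∃ j, i ≤ j ∧ a j) (g : ℕ → ℕ) :
    ∃ d : ℕ → ℕ, ∀ i, d i = if a i then g i else d (i + 1) := by
  classical
  refine ⟨fun i => g (Nat.find (ha i)), fun i => ?_⟩
  split_ifs with h
  · have : Nat.find (ha i) = i := (Nat.find_eq_iff _).2 ⟨⟨le_rfl, h⟩, fun j hj hc => by omega⟩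
    simp only [this]
  · have : Nat.find (ha i) = Nat.find (ha (i + 1)) := by
      refine (Nat.find_eq_iff _).2 ⟨?_, fun j hj hc => ?_⟩
      · have := Nat.find_spec (ha (i + 1))
        exact ⟨by omega, this.2⟩
      · refine Nat.find_min (ha (i + 1)) hj ⟨?_, hc.2⟩
        rcases hc.1.eq_or_lt with rfl | hlt
        · exact absurd hc.2 h
        · exact hlt
    simp only [this]

theorem lookahead_unique {a : ℕ → Prop} [DecidablePred a] (ha : ∀ i, ∃ j, i ≤ j ∧ a j) {g : ℕ → ℕ}
    {d d' : ℕ → ℕ} (hd : ∀ i, d i = if a i then g i else d (i + 1))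
    (hd' : ∀ i, d' i = if a i then g i else d' (i + 1)) : d = d' := by
  have key : ∀ n i, a (i + n) → d i = d' i := by
    intro n
    induction n with
    | zero => intro i h; rw [add_zero] at h; rw [hd, hd', if_pos h, if_pos h]
    | succ n ih =>
      intro i h
      rw [hd, hd', ih (i + 1) (by rwa [Nat.add_right_comm])]
  funext i
  obtain ⟨j, hij, hj⟩ := ha i
  exact key (j - i) i (by rwa [Nat.add_sub_cancel' hij])

/-- The carries of the local rule for a vertical and a horizontal strip. -/
def dualCarry (κ μ ρ : YoungDiagram) (n : ℕ) : ℕ → ℕ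
  | 0 => n
  | i + 1 => if κ.rowLen i ≤ μ.rowLen i then κ.rowLen i - ρ.rowLen i else dualCarry κ μ ρ n i

/-- The row lengths produced by the local rule for a vertical and a horizontal strip. -/
def dualRowInsert (κ μ ρ : YoungDiagram) (n i : ℕ) : ℕ :=
  if κ.rowLen i ≤ μ.rowLen i then μ.rowLen i + dualCarry κ μ ρ n i else κ.rowLen i

/-- The row lengths of the diagram removed by the local rule for a vertical and a horizontal
strip with carries `d`. -/
def dualRowDelete (κ μ : YoungDiagram) (d : ℕ → ℕ) (i : ℕ) : ℕ :=
  if κ.rowLen i ≤ μ.rowLen i then κ.rowLen i - d (i + 1) else κ.rowLen i - 1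

theorem dualCarry_le_one {κ μ ρ : YoungDiagram} (h : IsStrip true ρ κ) {n : ℕ} (hn : n ≤ 1)
    (i : ℕ) : dualCarry κ μ ρ n i ≤ 1 := by
  rw [isStrip_true_iff] at h
  induction i with
  | zero => exact hn
  | succ i ih =>
    have := h i
    rw [dualCarry]
    split_ifs <;> omega

/-- In a row with `κ_i > μ_i` everything is forced: `ν_i = κ_i = μ_i + 1` and `ρ_i = κ_i - 1`, so
the carry passes through. In a row with `κ_i ≤ μ_i` the incoming carry is `ν_i - μ_i` and the
outgoing one is `κ_i - ρ_i`, both `0` or `1`, and one is traded for the other. Insertion reads the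
carries from the top row down; deletion finds the carry at a forced row by looking ahead to the next
free one. -/
theorem exists_localRule_false_true (κ μ : YoungDiagram) :
    ∃ e : {ν // IsStrip false κ ν ∧ IsStrip true μ ν} ≃
        {n : ℕ // n ≤ 1} × {ρ // IsStrip true ρ κ ∧ IsStrip false ρ μ},
      ∀ ν, ν.1.card + (e ν).2.1.card = κ.card + μ.card + (e ν).1 := by
  classical
  obtain ⟨M₁, h₁⟩ := κ.exists_rowLen_eq_zero
  have hκ : ∀ i, κ.rowLen (i + 1) ≤ κ.rowLen i := fun i => κ.rowLen_anti _ _ (Nat.le_succ i)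
  have hμ : ∀ i, μ.rowLen (i + 1) ≤ μ.rowLen i := fun i => μ.rowLen_anti _ _ (Nat.le_succ i)
  have ha : ∀ i, ∃ j, i ≤ j ∧ κ.rowLen j ≤ μ.rowLen j := fun i =>
    ⟨i + M₁, by omega, by rw [h₁ _ (by omega)]; exact Nat.zero_le _⟩
  choose d hd using fun ν : {ν // IsStrip false κ ν ∧ IsStrip true μ ν} =>
    exists_lookahead ha fun i => ν.1.rowLen i - μ.rowLen i
  -- The second clause makes the subtraction `κ_i - d_{i+1}` exact. The third keeps its result at
  -- least `μ_{i+1}`, as a horizontal strip requires: if `κ_i ≤ μ_{i+1}`, then `ν_{i+1} ≤ κ_i`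
  -- leaves no room for a carry.
  have hd1 : ∀ ν i, d ν i ≤ 1 ∧ d ν (i + 1) ≤ κ.rowLen i ∧
      (κ.rowLen i ≤ μ.rowLen (i + 1) → d ν (i + 1) = 0) := by
    rintro ⟨ν, h, h'⟩
    rw [isStrip_false_iff] at h
    rw [isStrip_true_iff] at h'
    have hle : ∀ n i, κ.rowLen (i + n) ≤ μ.rowLen (i + n) → d ⟨ν, ‹_›, ‹_›⟩ i ≤ 1 := by
      intro n
      induction n with
      | zero =>
        intro i hi
        have := h' i
        rw [add_zero] at hi
        rw [hd, if_pos hi]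
        simp only
        omega
      | succ n ih =>
        intro i hi
        rw [hd]
        split_ifs
        · have := h' i
          simp only
          omega
        · exact ih (i + 1) (by rwa [Nat.add_right_comm])
    intro i
    refine ⟨?_, ?_⟩
    · obtain ⟨j, hij, hj⟩ := ha i
      exact hle (j - i) i (by rwa [Nat.add_sub_cancel' hij])
    · have h1 : d ⟨ν, ‹_›, ‹_›⟩ (i + 1) ≤ 1 := by
        obtain ⟨j, hij, hj⟩ := ha (i + 1)
        exact hle (j - (i + 1)) (i + 1) (by rwa [Nat.add_sub_cancel' hij])
      have h2 := hd ⟨ν, ‹_›, ‹_›⟩ (i + 1)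
      simp only at h2
      have := h i; have := h' (i + 1); have := hκ i; have := h (i + 1)
      split_ifs at h2 <;> constructor <;> intros <;> omega
  have hA : ∀ ν i, dualRowDelete κ μ (d ν) (i + 1) ≤ dualRowDelete κ μ (d ν) i := by
    intro ν i
    have := hd1 ν i; have := hd1 ν (i + 1); have := hκ i; have := hμ i
    have h := isStrip_false_iff.1 ν.2.1
    have h' := isStrip_true_iff.1 ν.2.2
    have := h i; have := h' i; have := h (i + 1); have := h' (i + 1)
    simp only [dualRowDelete]
    split_ifs <;> omega
  have hB : ∀ (n : {n : ℕ // n ≤ 1}) (ρ : {ρ // IsStrip true ρ κ ∧ IsStrip false ρ μ}) i,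
      dualRowInsert κ μ ρ.1 n.1 (i + 1) ≤ κ.rowLen i ∧
      κ.rowLen i ≤ dualRowInsert κ μ ρ.1 n.1 i ∧ μ.rowLen i ≤ dualRowInsert κ μ ρ.1 n.1 i ∧
      dualRowInsert κ μ ρ.1 n.1 i ≤ μ.rowLen i + 1 := by
    intro n ρ i
    have := dualCarry_le_one (μ := μ) ρ.2.1 n.2 i
    have := isStrip_true_iff.1 ρ.2.1 i
    have := isStrip_false_iff.1 ρ.2.2 i
    have := hκ i; have := hμ i
    rw [dualRowInsert, dualRowInsert, dualCarry]
    split_ifs <;> omega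
  have h3 : ∀ ν, dualRowDelete κ μ (d ν) M₁ = 0 := by
    intro ν
    simp [dualRowDelete, h₁ M₁ le_rfl]
  have h4 : ∀ (n : {n : ℕ // n ≤ 1}) (ρ : {ρ // IsStrip true ρ κ ∧ IsStrip false ρ μ}),
      dualRowInsert κ μ ρ.1 n.1 (M₁ + 1) = 0 := by
    intro n ρ
    have := hB n ρ M₁
    have := h₁ M₁ le_rfl
    omega
  have hC : ∀ (n : {n : ℕ // n ≤ 1}) (ρ : {ρ // IsStrip true ρ κ ∧ IsStrip false ρ μ}),
      IsStrip false κ (ofRows (dualRowInsert κ μ ρ.1 n.1)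
        (fun i => (hB n ρ i).1.trans (hB n ρ i).2.1) (M₁ + 1)) ∧
      IsStrip true μ (ofRows (dualRowInsert κ μ ρ.1 n.1)
        (fun i => (hB n ρ i).1.trans (hB n ρ i).2.1) (M₁ + 1)) := by
    intro n ρ
    simp only [isStrip_false_iff, isStrip_true_iff, rowLen_ofRows (h4 n ρ)]
    exact ⟨fun i => ⟨(hB n ρ i).2.1, (hB n ρ i).1⟩, fun i => (hB n ρ i).2.2⟩
  refine ⟨⟨fun ν => (⟨d ν 0, (hd1 ν 0).1⟩, ⟨ofRows _ (hA ν) M₁, ?_⟩),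
    fun p => ⟨_, hC p.1 p.2⟩, ?_, ?_⟩, ?_⟩
  · simp only [isStrip_false_iff, isStrip_true_iff, rowLen_ofRows (h3 ν), dualRowDelete]
    have h := isStrip_false_iff.1 ν.2.1
    have h' := isStrip_true_iff.1 ν.2.2
    constructor <;> intro i <;> have := h i <;> have := h' i <;> have := h (i + 1) <;>
      have := h' (i + 1) <;> have := hd1 ν i <;> have := hd1 ν (i + 1) <;> have := hμ i <;>
      split_ifs <;> omega
  · intro ν
    apply Subtype.ext
    apply ext_rowLen
    intro i
    simp only [rowLen_ofRows (h4 (⟨d ν 0, (hd1 ν 0).1⟩ : {n : ℕ // n ≤ 1}) ⟨ofRows _ (hA ν) M₁, _⟩)]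
    have hc : ∀ i, dualCarry κ μ (ofRows _ (hA ν) M₁) (d ν 0) i = d ν i := by
      intro i
      induction i with
      | zero => rfl
      | succ i ih =>
        have h1 := hd1 ν i
        have h2 := hd ν i
        rw [dualCarry, ih, rowLen_ofRows (h3 ν), dualRowDelete]
        split_ifs at h2 ⊢ <;> omega
    rw [dualRowInsert, hc]
    have h2 := hd ν i
    have := isStrip_false_iff.1 ν.2.1 i
    have := isStrip_true_iff.1 ν.2.2 i
    split_ifs at h2 ⊢ <;> omega
  · rintro ⟨n, ρ⟩
    -- The carries used for insertion satisfy the lookahead recursion of the inserted diagram, so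
    -- uniqueness identifies them with the carries that deletion reads off.
    have key : ∀ ν, (∀ i, ν.1.rowLen i = dualRowInsert κ μ ρ.1 n.1 i) →
        d ν = dualCarry κ μ ρ.1 n.1 := by
      intro ν hν
      refine lookahead_unique ha (hd ν) fun i => ?_
      rw [hν, dualRowInsert, dualCarry]
      split_ifs <;> omega
    have key' := key ⟨_, hC n ρ⟩ fun i =>
      rowLen_ofRows (hf := fun i => (hB n ρ i).1.trans (hB n ρ i).2.1) (h4 n ρ) i
    refine Prod.ext (Subtype.ext ?_) (Subtype.ext (ext_rowLen fun i => ?_))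
    · simp only [key', dualCarry]
    · simp only [rowLen_ofRows (h3 _)]
      simp only [dualRowDelete, key', dualCarry]
      have := isStrip_true_iff.1 ρ.2.1 i
      have := isStrip_false_iff.1 ρ.2.2 i
      split_ifs <;> omega
  · intro ν
    refine card_add_card_of_carry (d ν) (fun i => ?_) ?_
    · have h1 := hd1 ν i
      have h2 := hd ν i
      have := isStrip_false_iff.1 ν.2.1 i
      have := isStrip_true_iff.1 ν.2.2 i
      simp only [Equiv.coe_fn_mk, rowLen_ofRows (h3 ν), dualRowDelete]
      split_ifs at h2 ⊢ <;> omega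
    · obtain ⟨M, hM⟩ := ν.1.exists_rowLen_eq_zero
      refine ⟨M₁ + M, fun i hi => ?_⟩
      rw [hd, h₁ i (by omega), if_pos (Nat.zero_le _)]
      simp [hM i (by omega)]

theorem isStrip_transpose {b : Bool} {κ ν : YoungDiagram} :
    IsStrip b κ.transpose ν.transpose ↔ IsStrip (!b) κ ν := by
  cases b <;>
  · simp only [IsStrip, transpose_le_iff, mem_transpose, Prod.swap_prod_mk, Bool.not_true,
      Bool.not_false]
    exact and_congr_right fun _ => forall_comm

theorem card_transpose (μ : YoungDiagram) : μ.transpose.card = μ.card := by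
  simp [YoungDiagram.card, transpose]

/-- The local growth rule: adding strips of types `b` and `b'` on top of two diagrams is the same
as removing strips of these types from them, together with a multiplicity `n`, which is at most
one if the types differ. -/
theorem exists_localRule (b b' : Bool) (κ μ : YoungDiagram) :
    ∃ e : {ν // IsStrip b κ ν ∧ IsStrip b' μ ν} ≃
        {n : ℕ // b ≠ b' → n ≤ 1} × {ρ // IsStrip b' ρ κ ∧ IsStrip b ρ μ},
      ∀ ν, ν.1.card + (e ν).2.1.card = κ.card + μ.card + (e ν).1 := by
  cases b <;> cases b'
  · obtain ⟨e, he⟩ := exists_localRule_false_false κ μ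
    exact ⟨e.trans (Equiv.prodCongr (Equiv.subtypeUnivEquiv (by simp)).symm (Equiv.refl _)), he⟩
  · obtain ⟨e, he⟩ := exists_localRule_false_true κ μ
    exact ⟨e.trans (Equiv.prodCongr (Equiv.subtypeEquivRight (by simp)) (Equiv.refl _)), he⟩
  · obtain ⟨e, he⟩ := exists_localRule_false_true μ κ
    refine ⟨(Equiv.subtypeEquivRight fun ν => and_comm).trans (e.trans (Equiv.prodCongr
      (Equiv.subtypeEquivRight (by simp)) (Equiv.subtypeEquivRight fun ν => and_comm))),
      fun ν => ?_⟩
    rw [add_comm κ.card]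
    exact he ⟨ν.1, ν.2.symm⟩
  -- Transposition exchanges vertical and horizontal strips and preserves size.
  · obtain ⟨e, he⟩ := exists_localRule_false_false κ.transpose μ.transpose
    have h : ∀ κ ν : YoungDiagram, IsStrip true κ ν ↔ IsStrip false κ.transpose ν.transpose :=
      fun κ ν => (isStrip_transpose (b := false)).symm
    refine ⟨(transposeOrderIso.toEquiv.subtypeEquiv fun ν => and_congr (h _ _) (h _ _)).trans
      (e.trans (Equiv.prodCongr (Equiv.subtypeUnivEquiv (by simp)).symm
        (transposeOrderIso.toEquiv.subtypeEquiv fun ν => and_congr (h _ _) (h _ _)).symm)),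
      fun ν => ?_⟩
    have := he ⟨ν.1.transpose, (h _ _).1 ν.2.1, (h _ _).1 ν.2.2⟩
    rw [card_transpose, card_transpose, card_transpose] at this
    refine Eq.trans ?_ this
    congr 1
    exact card_transpose _

end YoungDiagram

/-! ### Weighted sets and their generating functions. -/

section Weighted

variable {σ A B C : Type*}

/-- `f` is the generating function of `A` with respect to the weight `w`, all of whose fibers are
finite. -/
def HasGeneratingFunction (w : A → σ →₀ ℕ) (f : MvPowerSeries σ ℤ) : Prop :=
  ∀ l, {a | w a = l}.Finite ∧ ({a | w a = l}.ncard : ℤ) = MvPowerSeries.coeff l f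

/-- There is a weight-preserving bijection. -/
def WeightEquiv (w : A → σ →₀ ℕ) (w' : B → σ →₀ ℕ) : Prop :=
  ∃ e : A ≃ B, ∀ a, w' (e a) = w a

theorem WeightEquiv.symm {w : A → σ →₀ ℕ} {w' : B → σ →₀ ℕ} (h : WeightEquiv w w') :
    WeightEquiv w' w := by
  obtain ⟨e, he⟩ := h
  exact ⟨e.symm, fun b => by rw [← he, e.apply_symm_apply]⟩

theorem WeightEquiv.trans {w : A → σ →₀ ℕ} {w' : B → σ →₀ ℕ} {w'' : C → σ →₀ ℕ}
    (h : WeightEquiv w w') (h' : WeightEquiv w' w'') : WeightEquiv w w'' := by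
  obtain ⟨e, he⟩ := h
  obtain ⟨e', he'⟩ := h'
  exact ⟨e.trans e', fun a => by rw [Equiv.trans_apply, he', he]⟩

theorem WeightEquiv.sigma {ι : Type*} {A B : ι → Type*} {w : (Σ i, A i) → σ →₀ ℕ}
    {w' : (Σ i, B i) → σ →₀ ℕ}
    (h : ∀ i, WeightEquiv (fun a => w ⟨i, a⟩) (fun b => w' ⟨i, b⟩)) : WeightEquiv w w' := by
  choose e he using h
  exact ⟨Equiv.sigmaCongrRight e, fun ⟨i, a⟩ => he i a⟩

theorem WeightEquiv.prod_left {w : C × A → σ →₀ ℕ} {w' : C × B → σ →₀ ℕ}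
    (h : ∀ c, WeightEquiv (fun a => w (c, a)) (fun b => w' (c, b))) : WeightEquiv w w' := by
  choose e he using h
  exact ⟨Equiv.prodShear (Equiv.refl C) e, fun ⟨c, a⟩ => he c a⟩

theorem WeightEquiv.prod_right {w : A × C → σ →₀ ℕ} {w' : B × C → σ →₀ ℕ}
    (h : ∃ e : A ≃ B, ∀ a c, w' (e a, c) = w (a, c)) : WeightEquiv w w' := by
  obtain ⟨e, he⟩ := h
  exact ⟨Equiv.prodCongr e (Equiv.refl C), fun ⟨a, c⟩ => he a c⟩

theorem HasGeneratingFunction.congr {w : A → σ →₀ ℕ} {w' : B → σ →₀ ℕ} {f : MvPowerSeries σ ℤ}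
    (hf : HasGeneratingFunction w f) (h : WeightEquiv w' w) : HasGeneratingFunction w' f := by
  obtain ⟨e, he⟩ := h
  intro l
  have hl : {b | w' b = l} = e ⁻¹' {a | w a = l} := by
    ext b
    simp [he]
  rw [hl]
  exact ⟨(hf l).1.preimage e.injective.injOn, by
    rw [Set.ncard_preimage_of_injective_subset_range e.injective (by simp), (hf l).2]⟩

theorem HasGeneratingFunction.of_unique [Unique A] {w : A → σ →₀ ℕ} (hw : w default = 0) :
    HasGeneratingFunction w 1 := by
  classical
  intro l
  refine ⟨Set.toFinite _, ?_⟩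
  rw [MvPowerSeries.coeff_one]
  split_ifs with h
  · have : {a | w a = l} = {default} := by
      ext a
      simp [Unique.eq_default a, hw, h]
    simp [this]
  · have : {a | w a = l} = ∅ := by
      ext a
      simp [Unique.eq_default a, hw, Ne.symm h]
    simp [this]

theorem HasGeneratingFunction.prod {w : A → σ →₀ ℕ} {w' : B → σ →₀ ℕ} {f g : MvPowerSeries σ ℤ}
    (hf : HasGeneratingFunction w f) (hg : HasGeneratingFunction w' g) :
    HasGeneratingFunction (fun p : A × B => w p.1 + w' p.2) (f * g) := by
  classical
  intro l
  have hl : {p : A × B | w p.1 + w' p.2 = l} =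
      ((Finset.HasAntidiagonal.antidiagonal l).biUnion fun q => (hf q.1).1.toFinset ×ˢ (hg q.2).1.toFinset :
        Finset (A × B)) := by
    ext ⟨a, b⟩
    simp
  rw [hl]
  refine ⟨Finset.finite_toSet _, ?_⟩
  rw [Set.ncard_coe_finset, Finset.card_biUnion, MvPowerSeries.coeff_mul]
  · push_cast
    refine Finset.sum_congr rfl fun q _ => ?_
    rw [Finset.card_product, ← Set.ncard_eq_toFinset_card _ (hf q.1).1,
      ← Set.ncard_eq_toFinset_card _ (hg q.2).1,
      Nat.cast_mul, (hf q.1).2, (hg q.2).2]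
  · rintro ⟨p, p'⟩ _ ⟨q, q'⟩ _ hpq
    refine Finset.disjoint_left.2 ?_
    rintro ⟨a, b⟩ h h'
    simp only [Finset.mem_product, Set.Finite.mem_toFinset, Set.mem_ofPred_eq] at h h'
    exact hpq (Prod.ext (h.1.symm.trans h'.1) (h.2.symm.trans h'.2))

/-- The generating function of the multiplicities in the local growth rule. -/
noncomputable def stripFactor (b b' : Bool) (e : σ →₀ ℕ) : MvPowerSeries σ ℤ :=
  if b = b' then Ring.inverse (1 - MvPowerSeries.monomial e 1) else 1 + MvPowerSeries.monomial e 1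

theorem hasGeneratingFunction_smul {e : σ →₀ ℕ} (he : e ≠ 0) :
    HasGeneratingFunction (fun n : ℕ => n • e)
      (Ring.inverse (1 - MvPowerSeries.monomial e (1 : ℤ))) := by
  classical
  have hinj : Function.Injective fun n : ℕ => n • e := by
    obtain ⟨i, hi⟩ := Finsupp.ne_iff.1 he
    intro a b hab
    have := DFunLike.congr_fun hab i
    simp only [Finsupp.coe_smul, Pi.smul_apply, smul_eq_mul] at this
    exact Nat.eq_of_mul_eq_mul_right (Nat.pos_of_ne_zero hi) this
  have hfin : ∀ l, {n : ℕ | n • e = l}.Finite := fun l =>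
    Set.Subsingleton.finite fun a ha b hb => hinj (ha.trans hb.symm)
  let g : MvPowerSeries σ ℤ := fun l => ({n : ℕ | n • e = l}.ncard : ℤ)
  have hg : ∀ l, MvPowerSeries.coeff l g = ({n : ℕ | n • e = l}.ncard : ℤ) := fun l => rfl
  -- The counting series `g` is the inverse because `n ↦ n + 1` shifts the weight by `e` and misses
  -- only `n = 0`.
  have hmul : (1 - MvPowerSeries.monomial e (1 : ℤ)) * g = 1 := by
    ext l
    rw [sub_mul, one_mul, map_sub, MvPowerSeries.coeff_monomial_mul, MvPowerSeries.coeff_one, hg,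
      hg, one_mul]
    by_cases hl : e ≤ l
    · have h0 : l ≠ 0 := by
        rintro rfl
        exact he (le_antisymm hl zero_le)
      have : {n : ℕ | n • e = l} = Nat.succ '' {n : ℕ | n • e = l - e} := by
        ext n
        cases n with
        | zero => simp [Ne.symm h0]
        | succ n =>
          simp only [Set.mem_ofPred_eq, Set.mem_image, Nat.succ_eq_add_one, add_left_inj,
            exists_eq_right, succ_nsmul]
          rw [eq_tsub_iff_add_eq_of_le hl]
      rw [if_pos hl, if_neg h0, this, Set.ncard_image_of_injective _ Nat.succ_injective, sub_self]
    · rw [if_neg hl, sub_zero]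
      split_ifs with h0
      · have : {n : ℕ | n • e = l} = {0} := by
          ext n
          simp [h0, he]
        simp [this]
      · have : {n : ℕ | n • e = l} = ∅ := by
          ext n
          simp only [Set.mem_ofPred_eq, Set.mem_empty_iff_false, iff_false]
          rintro rfl
          cases n with
          | zero => simp at h0
          | succ n => exact hl (by rw [succ_nsmul]; exact le_add_self)
        simp [this]
  have hinv : Ring.inverse (1 - MvPowerSeries.monomial e (1 : ℤ)) = g := by
    rw [← mul_one (Ring.inverse _), Ring.inverse_mul_eq_iff_eq_mul _ _ _
      (IsUnit.of_mul_eq_one _ hmul), hmul]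
  intro l
  exact ⟨hfin l, by rw [hinv, hg]⟩

theorem hasGeneratingFunction_stripFactor (b b' : Bool) {e : σ →₀ ℕ} (he : e ≠ 0) :
    HasGeneratingFunction (fun n : {n : ℕ // b ≠ b' → n ≤ 1} => n.1 • e)
      (stripFactor b b' e) := by
  classical
  by_cases h : b = b'
  · rw [stripFactor, if_pos h]
    exact (hasGeneratingFunction_smul he).congr
      ⟨Equiv.subtypeUnivEquiv fun n hn => absurd h hn, fun n => rfl⟩
  · rw [stripFactor, if_neg h]
    have hpos : ∀ n : {n : ℕ // b ≠ b' → n ≤ 1}, n = ⟨0, by simp⟩ ∨ n = ⟨1, by simp⟩ := by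
      rintro ⟨n, hn⟩
      have := hn h
      interval_cases n <;> simp
    intro l
    rw [map_add, MvPowerSeries.coeff_one, MvPowerSeries.coeff_monomial]
    by_cases h0 : l = 0
    · have : {n : {n : ℕ // b ≠ b' → n ≤ 1} | n.1 • e = l} = {⟨0, by simp⟩} := by
        ext n
        rcases hpos n with rfl | rfl <;> simp [h0, he]
      rw [this, if_pos h0, if_neg (by rw [h0]; exact he.symm)]
      simp
    · by_cases h1 : l = e
      · have : {n : {n : ℕ // b ≠ b' → n ≤ 1} | n.1 • e = l} = {⟨1, by simp⟩} := by
          ext n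
          rcases hpos n with rfl | rfl <;> simp [h1, he.symm]
        rw [this, if_neg h0, if_pos h1]
        simp
      · have : {n : {n : ℕ // b ≠ b' → n ≤ 1} | n.1 • e = l} = ∅ := by
          ext n
          rcases hpos n with rfl | rfl <;> simp [Ne.symm h0, Ne.symm h1]
        rw [this, if_neg h0, if_neg h1]
        simp

end Weighted

/-! ### Chains of strips and the supersymmetric Cauchy identity. -/

namespace YoungDiagram

variable {σ : Type*}

theorem card_mono {κ ν : YoungDiagram} (h : κ ≤ ν) : κ.card ≤ ν.card :=
  Finset.card_le_card (cells_subset_iff.2 h)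

theorem isStrip_bot (b : Bool) : IsStrip b ⊥ ⊥ := by
  cases b <;> simp [IsStrip]

/-- Chains of diagrams `λ = ν 0 ⊇ ν 1 ⊇ ⋯ ⊇ ν M = ∅` whose `i`-th difference is a strip of type
`ε i`. -/
@[ext]
structure StripChain (ε : ℕ → Bool) (M : ℕ) (μ : YoungDiagram) where
  diag : ℕ → YoungDiagram
  diag_zero : diag 0 = μ
  isStrip : ∀ i, IsStrip (ε i) (diag (i + 1)) (diag i)
  diag_eq_bot : diag M = ⊥

/-- The weight of a chain: each cell of its `i`-th difference has weight `x i`. -/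
noncomputable def chainWeight (x : ℕ → σ →₀ ℕ) (M : ℕ) (ν : ℕ → YoungDiagram) : σ →₀ ℕ :=
  ∑ i ∈ Finset.range M, ((ν i).card - (ν (i + 1)).card) • x i

theorem chainWeight_succ (x : ℕ → σ →₀ ℕ) (M : ℕ) (ν : ℕ → YoungDiagram) :
    chainWeight x (M + 1) ν = ((ν 0).card - (ν 1).card) • x 0 +
      chainWeight (fun i => x (i + 1)) M (fun i => ν (i + 1)) := by
  rw [chainWeight, Finset.sum_range_succ', add_comm]
  rfl

namespace StripChain

variable {ε : ℕ → Bool} {M : ℕ} {μ : YoungDiagram}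

theorem antitone (ν : StripChain ε M μ) : Antitone ν.1 :=
  antitone_nat_of_succ_le fun i => (ν.isStrip i).le

theorem eq_bot_of_zero (ν : StripChain ε 0 μ) : μ = ⊥ := ν.diag_zero.symm.trans ν.diag_eq_bot

instance uniqueBot : Unique (StripChain ε M ⊥) where
  default := ⟨fun _ => ⊥, rfl, fun _ => isStrip_bot _, rfl⟩
  uniq ν := StripChain.ext <| funext fun i => le_bot_iff.1 (by
    have := ν.antitone (Nat.zero_le i)
    rwa [ν.diag_zero] at this)

theorem chainWeight_default (x : ℕ → σ →₀ ℕ) :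
    chainWeight x M (default : StripChain ε M ⊥).1 = 0 := by
  refine Finset.sum_eq_zero fun i _ => ?_
  change (YoungDiagram.card ⊥ - YoungDiagram.card ⊥) • x i = 0
  rw [Nat.sub_self, zero_smul]

/-- Prepending a diagram to a chain. -/
def cons {κ : YoungDiagram} (h : IsStrip (ε 0) κ μ)
    (ν : StripChain (fun i => ε (i + 1)) M κ) : StripChain ε (M + 1) μ :=
  ⟨fun i => Nat.casesOn i μ ν.1, rfl, fun i => by
    cases i with
    | zero =>
      change IsStrip (ε 0) (ν.1 0) μ
      rwa [ν.diag_zero]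
    | succ i => exact ν.isStrip i, ν.diag_eq_bot⟩

/-- A chain of positive length is a first step followed by a shorter chain. -/
def succEquiv : StripChain ε (M + 1) μ ≃
    Σ κ : {κ // IsStrip (ε 0) κ μ}, StripChain (fun i => ε (i + 1)) M κ.1 where
  toFun ν := ⟨⟨ν.1 1, by simpa only [ν.diag_zero] using ν.isStrip 0⟩,
    ⟨fun i => ν.1 (i + 1), rfl, fun i => ν.isStrip (i + 1), ν.diag_eq_bot⟩⟩
  invFun p := cons p.1.2 p.2
  left_inv ν := StripChain.ext <| funext fun i => by
    cases i with
    | zero => exact ν.diag_zero.symm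
    | succ i => rfl
  right_inv := by
    rintro ⟨⟨κ, hκ⟩, ⟨ν, h0, h⟩⟩
    obtain rfl : ν 0 = κ := h0
    rfl

theorem weightEquiv_succ (x : ℕ → σ →₀ ℕ) :
    WeightEquiv (fun ν : StripChain ε (M + 1) μ => chainWeight x (M + 1) ν.1)
      (fun p : Σ κ : {κ // IsStrip (ε 0) κ μ}, StripChain (fun i => ε (i + 1)) M κ.1 =>
        (μ.card - p.1.1.card) • x 0 + chainWeight (fun i => x (i + 1)) M p.2.1) :=
  ⟨succEquiv, fun ν => by simp only [chainWeight_succ, ν.diag_zero]; rfl⟩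

end StripChain

/-- Exchanging the addition of a strip of type `b` with the removal of a strip of type `b'`. -/
theorem weightEquiv_localRule (b b' : Bool) (x y : σ →₀ ℕ) (κ : YoungDiagram)
    {S : YoungDiagram → Type*} (w : ∀ μ, S μ → σ →₀ ℕ) :
    WeightEquiv
      (fun p : Σ ν : {ν // IsStrip b κ ν}, Σ μ : {μ // IsStrip b' μ ν.1}, S μ.1 =>
        (p.1.1.card - κ.card) • x + ((p.1.1.card - p.2.1.1.card) • y + w _ p.2.2))
      (fun p : {n : ℕ // b ≠ b' → n ≤ 1} × Σ ρ : {ρ // IsStrip b' ρ κ},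
          Σ μ : {μ // IsStrip b ρ.1 μ}, S μ.1 =>
        p.1.1 • (x + y) + ((κ.card - p.2.1.1.card) • y +
          ((p.2.2.1.1.card - p.2.1.1.card) • x + w _ p.2.2.2))) := by
  have h1 : WeightEquiv
      -- Grouping by `μ` instead of `ν` leaves `κ` and `μ` fixed, so that the growth rule applies
      -- within each group.
      (fun p : Σ ν : {ν // IsStrip b κ ν}, Σ μ : {μ // IsStrip b' μ ν.1}, S μ.1 =>
        (p.1.1.card - κ.card) • x + ((p.1.1.card - p.2.1.1.card) • y + w _ p.2.2))
      (fun p : Σ μ : YoungDiagram, {ν // IsStrip b κ ν ∧ IsStrip b' μ ν} × S μ =>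
        (p.2.1.1.card - κ.card) • x + ((p.2.1.1.card - p.1.card) • y + w _ p.2.2)) :=
    ⟨⟨fun p => ⟨p.2.1.1, ⟨p.1.1, p.1.2, p.2.1.2⟩, p.2.2⟩,
      fun p => ⟨⟨p.2.1.1, p.2.1.2.1⟩, ⟨p.1, p.2.1.2.2⟩, p.2.2⟩,
      fun _ => rfl, fun _ => rfl⟩, fun _ => rfl⟩
  have h2 : WeightEquiv
      (fun p : Σ μ : YoungDiagram, {ν // IsStrip b κ ν ∧ IsStrip b' μ ν} × S μ =>
        (p.2.1.1.card - κ.card) • x + ((p.2.1.1.card - p.1.card) • y + w _ p.2.2))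
      (fun p : Σ μ : YoungDiagram, ({n : ℕ // b ≠ b' → n ≤ 1} ×
          {ρ // IsStrip b' ρ κ ∧ IsStrip b ρ μ}) × S μ =>
        p.2.1.1.1 • (x + y) + ((κ.card - p.2.1.2.1.card) • y +
          ((p.1.card - p.2.1.2.1.card) • x + w _ p.2.2))) := by
    refine WeightEquiv.sigma fun μ => WeightEquiv.prod_right ?_
    obtain ⟨e, he⟩ := exists_localRule b b' κ μ
    refine ⟨e, fun ν s => ?_⟩
    have h := he ν
    have hκ := card_mono ν.2.1.le
    have hμ := card_mono ν.2.2.le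
    have hκ' := card_mono (e ν).2.2.1.le
    have hμ' := card_mono (e ν).2.2.2.le
    -- All four inclusions make the subtractions exact, so the single size identity of the growth
    -- rule yields both the `x`-exponent and the `y`-exponent.
    have hx : ν.1.card - κ.card = (e ν).1.1 + (μ.card - (e ν).2.1.card) := by omega
    have hy : ν.1.card - μ.card = (e ν).1.1 + (κ.card - (e ν).2.1.card) := by omega
    simp only [hx, hy, add_smul, smul_add]
    abel
  refine h1.trans (h2.trans ?_)
  exact ⟨⟨fun p => (p.2.1.1, ⟨⟨p.2.1.2.1, p.2.1.2.2.1⟩, ⟨p.1, p.2.1.2.2.2⟩, p.2.2⟩),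
      fun p => ⟨p.2.2.1.1, (p.1, ⟨p.2.1.1, p.2.1.2, p.2.2.1.2⟩), p.2.2.2⟩,
      fun _ => rfl, fun _ => rfl⟩, fun _ => rfl⟩

/-- Adding a strip on top of a chain amounts to multiplying by a factor for each step of the
chain. -/
theorem exists_weightEquiv_sigma_stripChain (b : Bool) (x : σ →₀ ℕ) (M : ℕ) :
    ∀ (ε : ℕ → Bool) (y : ℕ → σ →₀ ℕ), (∀ i, x + y i ≠ 0) →
    ∃ (C : Type) (w : C → σ →₀ ℕ),
      HasGeneratingFunction w (∏ i ∈ Finset.range M, stripFactor b (ε i) (x + y i)) ∧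
      ∀ κ : YoungDiagram, WeightEquiv
        (fun p : Σ ν : {ν // IsStrip b κ ν}, StripChain ε M ν.1 =>
          (p.1.1.card - κ.card) • x + chainWeight y M p.2.1)
        (fun p : C × StripChain ε M κ => w p.1 + chainWeight y M p.2.1) := by
  induction M with
  | zero =>
    intro ε y _
    refine ⟨Unit, fun _ => 0, by simpa using HasGeneratingFunction.of_unique rfl, fun κ => ?_⟩
    -- A chain of length zero forces `ν = ⊥`, hence `κ = ⊥`: only the empty strip can be added.
    have hbot : ∀ ν : {ν // IsStrip b κ ν}, StripChain ε 0 ν.1 → ν.1 = κ := fun ν s =>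
      s.eq_bot_of_zero.trans (le_bot_iff.1 (s.eq_bot_of_zero ▸ ν.2.le)).symm
    refine ⟨⟨fun p => ((), ⟨p.2.1, p.2.2.trans (hbot _ p.2), p.2.3, p.2.4⟩),
      fun p => ⟨⟨κ, by rw [p.2.eq_bot_of_zero]; exact isStrip_bot b⟩, p.2⟩, ?_, fun _ => rfl⟩, ?_⟩
    · rintro ⟨ν, s⟩
      obtain ⟨ν, hν⟩ := ν
      obtain rfl : ν = κ := hbot ⟨ν, hν⟩ s
      rfl
    · rintro ⟨ν, s⟩
      simp [hbot ν s, chainWeight]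
  | succ M ih =>
    intro ε y hy
    -- `C` and `w` do not depend on the diagram, so one factor serves for every `ρ` that occurs
    -- after the exchange.
    obtain ⟨C, w, hw, hC⟩ := ih (fun i => ε (i + 1)) (fun i => y (i + 1)) fun i => hy _
    refine ⟨{n : ℕ // b ≠ ε 0 → n ≤ 1} × C, fun p => p.1.1 • (x + y 0) + w p.2, ?_, fun κ => ?_⟩
    · rw [Finset.prod_range_succ', mul_comm]
      exact (hasGeneratingFunction_stripFactor b (ε 0) (hy 0)).prod hw
    have h1 : WeightEquiv
        (fun p : Σ ν : {ν // IsStrip b κ ν}, StripChain ε (M + 1) ν.1 =>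
          (p.1.1.card - κ.card) • x + chainWeight y (M + 1) p.2.1)
        (fun p : Σ ν : {ν // IsStrip b κ ν}, Σ μ : {μ // IsStrip (ε 0) μ ν.1},
            StripChain (fun i => ε (i + 1)) M μ.1 =>
          (p.1.1.card - κ.card) • x + ((p.1.1.card - p.2.1.1.card) • y 0 +
            chainWeight (fun i => y (i + 1)) M p.2.2.1)) := by
      refine WeightEquiv.sigma fun ν => ?_
      obtain ⟨e, he⟩ := StripChain.weightEquiv_succ (ε := ε) (M := M) (μ := ν.1) y
      exact ⟨e, fun s => congrArg _ (he s)⟩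
    have h2 := weightEquiv_localRule b (ε 0) x (y 0) κ
      (S := fun μ => StripChain (fun i => ε (i + 1)) M μ)
      fun μ s => chainWeight (fun i => y (i + 1)) M s.1
    refine h1.trans (h2.trans ?_)
    have h3 : WeightEquiv
        (fun p : {n : ℕ // b ≠ ε 0 → n ≤ 1} × Σ ρ : {ρ // IsStrip (ε 0) ρ κ},
            Σ μ : {μ // IsStrip b ρ.1 μ}, StripChain (fun i => ε (i + 1)) M μ.1 =>
          p.1.1 • (x + y 0) + ((κ.card - p.2.1.1.card) • y 0 +
            ((p.2.2.1.1.card - p.2.1.1.card) • x +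
              chainWeight (fun i => y (i + 1)) M p.2.2.2.1)))
        (fun p : {n : ℕ // b ≠ ε 0 → n ≤ 1} × Σ ρ : {ρ // IsStrip (ε 0) ρ κ},
            C × StripChain (fun i => ε (i + 1)) M ρ.1 =>
          p.1.1 • (x + y 0) + ((κ.card - p.2.1.1.card) • y 0 +
            (w p.2.2.1 + chainWeight (fun i => y (i + 1)) M p.2.2.2.1))) := by
      refine WeightEquiv.prod_left fun n => WeightEquiv.sigma fun ρ => ?_
      obtain ⟨e, he⟩ := hC ρ.1
      exact ⟨e, fun s => congrArg _ (congrArg _ (he s))⟩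
    have h4 : WeightEquiv
        (fun p : {n : ℕ // b ≠ ε 0 → n ≤ 1} × Σ ρ : {ρ // IsStrip (ε 0) ρ κ},
            C × StripChain (fun i => ε (i + 1)) M ρ.1 =>
          p.1.1 • (x + y 0) + ((κ.card - p.2.1.1.card) • y 0 +
            (w p.2.2.1 + chainWeight (fun i => y (i + 1)) M p.2.2.2.1)))
        (fun p : ({n : ℕ // b ≠ ε 0 → n ≤ 1} × C) × Σ ρ : {ρ // IsStrip (ε 0) ρ κ},
            StripChain (fun i => ε (i + 1)) M ρ.1 =>
          p.1.1.1 • (x + y 0) + w p.1.2 + ((κ.card - p.2.1.1.card) • y 0 +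
            chainWeight (fun i => y (i + 1)) M p.2.2.1)) :=
      ⟨⟨fun p => ((p.1, p.2.2.1), ⟨p.2.1, p.2.2.2⟩), fun p => (p.1.1, ⟨p.2.1, p.1.2, p.2.2⟩),
        fun _ => rfl, fun _ => rfl⟩, fun p => by simp only [Equiv.coe_fn_mk]; abel⟩
    refine h3.trans (h4.trans (WeightEquiv.prod_left fun c => ?_))
    obtain ⟨e, he⟩ := (StripChain.weightEquiv_succ (ε := ε) (M := M) (μ := κ) y).symm
    exact ⟨e, fun s => congrArg _ (he s)⟩

/-- A supersymmetric Cauchy identity: the generating function of pairs of strip chains with the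
same initial diagram. -/
theorem hasGeneratingFunction_stripChain_pair (ε' : ℕ → Bool) (M' : ℕ) (y : ℕ → σ →₀ ℕ) (M : ℕ) :
    ∀ (ε : ℕ → Bool) (x : ℕ → σ →₀ ℕ), (∀ i j, x i + y j ≠ 0) →
    HasGeneratingFunction
      (fun p : Σ μ, StripChain ε M μ × StripChain ε' M' μ =>
        chainWeight x M p.2.1.1 + chainWeight y M' p.2.2.1)
      (∏ i ∈ Finset.range M, ∏ j ∈ Finset.range M', stripFactor (ε i) (ε' j) (x i + y j)) := by
  induction M with
  | zero =>
    intro ε x _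
    let _ : Unique (Σ μ, StripChain ε 0 μ × StripChain ε' M' μ) :=
      { default := ⟨⊥, default, default⟩
        uniq := by
          rintro ⟨μ, s, t⟩
          obtain rfl := s.eq_bot_of_zero
          rw [Unique.eq_default s, Unique.eq_default t] }
    rw [Finset.range_zero, Finset.prod_empty]
    refine HasGeneratingFunction.of_unique ?_
    change chainWeight x 0 _ + chainWeight y M' (default : StripChain ε' M' ⊥).1 = 0
    rw [StripChain.chainWeight_default]
    simp [chainWeight]
  | succ M ih =>
    intro ε x hxy
    obtain ⟨C, w, hw, hC⟩ := exists_weightEquiv_sigma_stripChain (ε 0) (x 0) M' ε' y (hxy 0)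
    have ih' := ih (fun i => ε (i + 1)) (fun i => x (i + 1)) fun i => hxy _
    rw [Finset.prod_range_succ', mul_comm]
    refine (hw.prod ih').congr ?_
    have h1 : WeightEquiv
        (fun p : Σ μ, StripChain ε (M + 1) μ × StripChain ε' M' μ =>
          chainWeight x (M + 1) p.2.1.1 + chainWeight y M' p.2.2.1)
        (fun p : Σ μ : YoungDiagram, (Σ κ : {κ // IsStrip (ε 0) κ μ},
            StripChain (fun i => ε (i + 1)) M κ.1) × StripChain ε' M' μ =>
          ((p.1.card - p.2.1.1.1.card) • x 0 + chainWeight (fun i => x (i + 1)) M p.2.1.2.1) +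
            chainWeight y M' p.2.2.1) := by
      refine WeightEquiv.sigma fun μ => WeightEquiv.prod_right ?_
      obtain ⟨e, he⟩ := StripChain.weightEquiv_succ (ε := ε) (M := M) (μ := μ) x
      exact ⟨e, fun s t => congrArg (· + _) (he s)⟩
    -- The first strip of the left chain is read from its smaller diagram `κ`, as a strip added to
    -- `κ` on top of which the right chain starts. It can then be absorbed into a factor.
    have h2 : WeightEquiv
        (fun p : Σ μ : YoungDiagram, (Σ κ : {κ // IsStrip (ε 0) κ μ},
            StripChain (fun i => ε (i + 1)) M κ.1) × StripChain ε' M' μ =>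
          ((p.1.card - p.2.1.1.1.card) • x 0 + chainWeight (fun i => x (i + 1)) M p.2.1.2.1) +
            chainWeight y M' p.2.2.1)
        (fun p : Σ κ : YoungDiagram, StripChain (fun i => ε (i + 1)) M κ ×
            Σ μ : {μ // IsStrip (ε 0) κ μ}, StripChain ε' M' μ.1 =>
          chainWeight (fun i => x (i + 1)) M p.2.1.1 +
            ((p.2.2.1.1.card - p.1.card) • x 0 + chainWeight y M' p.2.2.2.1)) :=
      ⟨⟨fun p => ⟨p.2.1.1.1, p.2.1.2, ⟨p.1, p.2.1.1.2⟩, p.2.2⟩,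
        fun p => ⟨p.2.2.1.1, ⟨⟨p.1, p.2.2.1.2⟩, p.2.1⟩, p.2.2.2⟩,
        fun _ => rfl, fun _ => rfl⟩, fun p => by simp only [Equiv.coe_fn_mk]; abel⟩
    have h3 : WeightEquiv
        (fun p : Σ κ : YoungDiagram, StripChain (fun i => ε (i + 1)) M κ ×
            Σ μ : {μ // IsStrip (ε 0) κ μ}, StripChain ε' M' μ.1 =>
          chainWeight (fun i => x (i + 1)) M p.2.1.1 +
            ((p.2.2.1.1.card - p.1.card) • x 0 + chainWeight y M' p.2.2.2.1))
        (fun p : Σ κ : YoungDiagram, StripChain (fun i => ε (i + 1)) M κ ×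
            (C × StripChain ε' M' κ) =>
          chainWeight (fun i => x (i + 1)) M p.2.1.1 +
            (w p.2.2.1 + chainWeight y M' p.2.2.2.1)) := by
      refine WeightEquiv.sigma fun κ => WeightEquiv.prod_left fun s => ?_
      obtain ⟨e, he⟩ := hC κ
      exact ⟨e, fun t => congrArg _ (he t)⟩
    refine h1.trans (h2.trans (h3.trans ?_))
    exact ⟨⟨fun p => (p.2.2.1, ⟨p.1, p.2.1, p.2.2.2⟩), fun p => ⟨p.2.1, p.2.2.1, p.1, p.2.2.2⟩,
      fun _ => rfl, fun _ => rfl⟩, fun p => by simp only [Equiv.coe_fn_mk]; abel⟩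

end YoungDiagram

/-! ### Coefficientwise convergence of infinite products. -/

namespace MvPowerSeries

variable {σ : Type*}

theorem coeff_mul_congr {R : Type*} [CommSemiring R] {d : ℕ} {f f' g g' : MvPowerSeries σ R}
    (hf : ∀ l : σ →₀ ℕ, l.degree < d → coeff l f = coeff l f')
    (hg : ∀ l : σ →₀ ℕ, l.degree < d → coeff l g = coeff l g') (l : σ →₀ ℕ) (hl : l.degree < d) :
    coeff l (f * g) = coeff l (f' * g') := by
  classical
  rw [coeff_mul, coeff_mul]
  refine Finset.sum_congr rfl fun p hp => ?_
  rw [Finset.HasAntidiagonal.mem_antidiagonal] at hp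
  rw [← hp, map_add] at hl
  rw [hf _ (by omega), hg _ (by omega)]

theorem coeff_prod_eq_coeff_one {R ι : Type*} [CommSemiring R] {d : ℕ} {f : ι → MvPowerSeries σ R}
    (s : Finset ι) (hf : ∀ i ∈ s, ∀ l : σ →₀ ℕ, l.degree < d → coeff l (f i) = coeff l 1)
    (l : σ →₀ ℕ) (hl : l.degree < d) : coeff l (∏ i ∈ s, f i) = coeff l 1 := by
  classical
  induction s using Finset.induction_on generalizing l with
  | empty => rw [Finset.prod_empty]
  | insert i s hi ih =>
    rw [Finset.prod_insert hi, coeff_mul_congr (f' := 1) (g' := 1)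
      (hf i (Finset.mem_insert_self i s))
      (fun l hl => ih (fun j hj => hf j (Finset.mem_insert_of_mem hj)) l hl) l hl, mul_one]

/-- A product converges if each coefficient is the one of a finite product, all other factors
being `1` up to the degree of that coefficient. -/
theorem hasProd_of_coeff {R ι : Type*} [CommSemiring R] [TopologicalSpace R]
    {f : ι → MvPowerSeries σ R} {g : MvPowerSeries σ R}
    (h : ∀ l : σ →₀ ℕ, ∃ s : Finset ι, coeff l g = coeff l (∏ i ∈ s, f i) ∧
      ∀ i ∉ s, ∀ l' : σ →₀ ℕ, l'.degree ≤ l.degree → coeff l' (f i) = coeff l' 1) :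
    HasProd f g := by
  classical
  rw [HasProd, SummationFilter.unconditional_filter,
    MvPowerSeries.WithPiTopology.tendsto_iff_coeff_tendsto]
  intro l
  obtain ⟨s, hs, hf⟩ := h l
  refine tendsto_const_nhds.congr' ?_
  filter_upwards [Filter.eventually_ge_atTop s] with t ht
  rw [hs, ← Finset.prod_sdiff ht, ← one_mul (∏ i ∈ s, f i)]
  refine (coeff_mul_congr (d := l.degree + 1) (fun l' hl' => ?_) (fun _ _ => by rw [one_mul]) l
    (Nat.lt_succ_self _)).symm
  refine coeff_prod_eq_coeff_one _ (fun i hi l'' hl'' => ?_) l' hl'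
  exact hf i (Finset.mem_sdiff.1 hi).2 l'' (Nat.lt_succ_iff.1 hl'')

end MvPowerSeries

/-- The factor counts multiples `n • e`, and only `n = 0` has degree below that of `e`. -/
theorem coeff_stripFactor_of_degree_lt {σ : Type*} (b b' : Bool) {e l : σ →₀ ℕ}
    (h : l.degree < e.degree) :
    MvPowerSeries.coeff l (stripFactor b b' e) = MvPowerSeries.coeff l 1 := by
  classical
  have he : e ≠ 0 := by
    rintro rfl
    simp at h
  rw [← (hasGeneratingFunction_stripFactor b b' he l).2, MvPowerSeries.coeff_one]
  split_ifs with h0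
  · have : {n : {n : ℕ // b ≠ b' → n ≤ 1} | n.1 • e = l} = {⟨0, by simp⟩} := by
      ext n
      simp [h0, he, Subtype.ext_iff]
    rw [this]
    simp
  · have : {n : {n : ℕ // b ≠ b' → n ≤ 1} | n.1 • e = l} = ∅ := by
      ext ⟨n, hn⟩
      simp only [Set.mem_ofPred_eq, Set.mem_empty_iff_false, iff_false]
      rintro rfl
      cases n with
      | zero => simp at h0
      | succ n =>
        rw [succ_nsmul, map_add] at h
        omega
    rw [this]
    simp

/-! ### Signs, exponents and root factors. -/

namespace ParitySequence

variable {m n : ℕ} (s : ParitySequence m n)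

theorem neg_one_zpow_nodeParity (i : ℤ) :
    (-1 : ℤˣ) ^ s.nodeParity i = s.sign i * s.sign (i + 1) := by
  rw [nodeParity]
  rcases Int.units_eq_one_or (s.sign i) with h | h <;>
    rcases Int.units_eq_one_or (s.sign (i + 1)) with h' | h' <;> simp [h, h']

/-- Each node contributes the product of its two adjacent signs, and the inner signs occur twice. -/
theorem sigma_eq (i : ℤ) (d : ℕ) : s.sigma i (i + d) = s.sign i * s.sign (i + d + 1) := by
  induction d with
  | zero => simp [sigma, neg_one_zpow_nodeParity]
  | succ d ih =>
    have hIcc : Finset.Icc i (i + (d + 1 : ℕ)) = insert (i + d + 1) (Finset.Icc i (i + d)) := by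
      ext t
      simp only [Finset.mem_Icc, Finset.mem_insert]
      omega
    rw [sigma] at ih ⊢
    rw [hIcc, Finset.sum_insert (by simp), zpow_add, ih, neg_one_zpow_nodeParity]
    push_cast
    rw [← add_assoc, mul_comm (s.sign i), mul_mul_mul_comm, Int.units_mul_self, one_mul, mul_comm]

end ParitySequence

/-- The exponent of `z_{k-i} z_{k-i+1} ⋯ z_{k-1}`. -/
noncomputable def leftExponent (m n : ℕ) (k : ℤ) (i : ℕ) : ZMod (m + n) →₀ ℕ :=
  ∑ t ∈ Finset.range i, Finsupp.single ((k - 1 - t : ℤ) : ZMod (m + n)) 1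

/-- The exponent of `z_k z_{k+1} ⋯ z_{k+j}`. -/
noncomputable def rightExponent (m n : ℕ) (k : ℤ) (j : ℕ) : ZMod (m + n) →₀ ℕ :=
  ∑ t ∈ Finset.range (j + 1), Finsupp.single ((k + t : ℤ) : ZMod (m + n)) 1

theorem degree_leftExponent_add_rightExponent (m n : ℕ) (k : ℤ) (i j : ℕ) :
    (leftExponent m n k i + rightExponent m n k j).degree = i + (j + 1) := by
  simp [leftExponent, rightExponent, map_sum, Finsupp.degree_single]

theorem zInterval_eq_monomial (m n : ℕ) (k : ℤ) (i j : ℕ) :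
    zInterval m n (k - i) (k + j) =
      MvPowerSeries.monomial (leftExponent m n k i + rightExponent m n k j) 1 := by
  induction i with
  | succ i ih =>
    have hIcc : Finset.Icc (k - (i + 1 : ℕ)) (k + j) =
        insert (k - 1 - i) (Finset.Icc (k - i) (k + j)) := by
      ext t
      simp only [Finset.mem_Icc, Finset.mem_insert]
      omega
    rw [zInterval] at ih ⊢
    rw [hIcc, Finset.prod_insert (by simp), ih, leftExponent, leftExponent,
      Finset.sum_range_succ, MvPowerSeries.X, MvPowerSeries.monomial_mul_monomial, mul_one]
    congr 2
    abel
  | zero =>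
    induction j with
    | zero => simp [zInterval, leftExponent, rightExponent, MvPowerSeries.X]
    | succ j ih =>
      have hIcc : Finset.Icc (k - (0 : ℕ)) (k + (j + 1 : ℕ)) =
          insert (k + (j + 1 : ℕ)) (Finset.Icc (k - (0 : ℕ)) (k + j)) := by
        ext t
        simp only [Finset.mem_Icc, Finset.mem_insert]
        omega
      rw [zInterval] at ih ⊢
      rw [hIcc, Finset.prod_insert (by simp), ih, rightExponent, rightExponent,
        Finset.sum_range_succ _ (j + 1), MvPowerSeries.X, MvPowerSeries.monomial_mul_monomial,
        mul_one]
      congr 2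
      abel

/-- By telescoping, `σ = 1` exactly when the two outer signs agree. Comparing each of them with
`s_k` does not change whether they agree, and turns them into the strip types. -/
theorem rootFactor_eq_stripFactor {m n : ℕ} (s : ParitySequence m n) (k : ℤ) (i j : ℕ) :
    rootFactor s (k - i) (k + j) =
      stripFactor (decide (s.sign (k - i) = s.sign k)) (decide (s.sign (k + (j + 1 : ℕ)) = s.sign k))
        (leftExponent m n k i + rightExponent m n k j) := by
  have hσ : s.sigma (k - i) (k + j) = s.sign (k - i) * s.sign (k + (j + 1 : ℕ)) := by
    have h := s.sigma_eq (k - i) (i + j)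
    have h1 : k - i + ((i + j : ℕ) : ℤ) = k + j := by push_cast; ring
    rw [h1] at h
    rw [h]
    push_cast
    rw [add_assoc]
  rw [rootFactor, hσ, zInterval_eq_monomial, stripFactor]
  rcases Int.units_eq_one_or (s.sign (k - i)) with h | h <;>
    rcases Int.units_eq_one_or (s.sign (k + (j + 1 : ℕ))) with h' | h' <;>
    rcases Int.units_eq_one_or (s.sign k) with h'' | h'' <;> rw [h, h', h''] <;> simp

/-! ### Piles of boxes, their slices and their heights. -/

/-- The support is an initial segment. This turns the length comparisons between layers into
conditions on single parts. -/
theorem Finsupp.lt_card_support_iff {f : ℕ →₀ ℕ} (hf : ∀ j, f (j + 1) ≤ f j) {j : ℕ} :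
    j < f.support.card ↔ f j ≠ 0 := by
  have hanti : Antitone f := antitone_nat_of_succ_le hf
  have hex : ∃ j, f j = 0 := by
    obtain ⟨j, hj⟩ := Infinite.exists_notMem_finset f.support
    exact ⟨j, by simpa using hj⟩
  have key : ∀ j, j < Nat.find hex ↔ f j ≠ 0 := by
    intro j
    rw [Nat.lt_find_iff]
    refine ⟨fun h => h j le_rfl, fun h i hi h0 => h ?_⟩
    have := hanti hi
    omega
  have hsupp : f.support = Finset.range (Nat.find hex) := by
    ext j
    rw [Finset.mem_range, key, Finsupp.mem_support_iff]
  rw [hsupp, Finset.card_range, key]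

namespace YoungDiagram

/-- The slice at height `d` of a pile of boxes with height `F j a` over the cell `(j, a)`. -/
noncomputable def slice (F : ℕ → ℕ → ℕ) (hj : ∀ j a, F (j + 1) a ≤ F j a)
    (ha : ∀ j a, F j (a + 1) ≤ F j a) (hfin : {p : ℕ × ℕ | F p.1 p.2 ≠ 0}.Finite) (d : ℕ) :
    YoungDiagram where
  cells := hfin.toFinset.filter fun p => d < F p.1 p.2
  isLowerSet := by
    rintro ⟨j, a⟩ ⟨j', a'⟩ ⟨h1 : j' ≤ j, h2 : a' ≤ a⟩ h
    simp only [Finset.coe_filter, Set.Finite.mem_toFinset, Set.mem_ofPred_eq] at h ⊢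
    have h3 : F j a ≤ F j' a := antitone_nat_of_succ_le (f := fun j => F j a) (fun j => hj j a) h1
    have h4 : F j' a ≤ F j' a' := antitone_nat_of_succ_le (f := fun a => F j' a) (ha j') h2
    omega

theorem mem_slice {F : ℕ → ℕ → ℕ} {hj : ∀ j a, F (j + 1) a ≤ F j a}
    {ha : ∀ j a, F j (a + 1) ≤ F j a} {hfin : {p : ℕ × ℕ | F p.1 p.2 ≠ 0}.Finite} {d j a : ℕ} :
    (j, a) ∈ slice F hj ha hfin d ↔ d < F j a := by
  rw [← mem_cells]
  simp only [slice, Finset.mem_filter, Set.Finite.mem_toFinset, Set.mem_ofPred_eq]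
  omega

theorem height_antitone {ν : ℕ → YoungDiagram} {F : ℕ → ℕ → ℕ}
    (hν : ∀ d j a, (j, a) ∈ ν d ↔ d < F j a) (j a : ℕ) :
    F (j + 1) a ≤ F j a ∧ F j (a + 1) ≤ F j a := by
  constructor <;> by_contra! h
  · exact lt_irrefl _ ((hν _ _ _).1 ((ν _).up_left_mem (Nat.le_succ j) le_rfl ((hν _ _ _).2 h)))
  · exact lt_irrefl _ ((hν _ _ _).1 ((ν _).up_left_mem le_rfl (Nat.le_succ a) ((hν _ _ _).2 h)))

/-- The cells removed at step `d` are those of height `d + 1`. The strip condition forbids two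
adjacent ones, in the direction of `a` for a vertical strip and of `j` for a horizontal one. -/
theorem isStrip_iff_of_height {ν : ℕ → YoungDiagram} {F : ℕ → ℕ → ℕ}
    (hν : ∀ d j a, (j, a) ∈ ν d ↔ d < F j a) {b : Bool} {d : ℕ} :
    IsStrip b (ν (d + 1)) (ν d) ↔
      (b = true → ∀ j a, F j a = F j (a + 1) → F j a ≠ d + 1) ∧
      (b = false → ∀ j a, F j a = F (j + 1) a → F j a ≠ d + 1) := by
  have hle : ν (d + 1) ≤ ν d := by
    rintro ⟨j, a⟩ h
    exact (hν _ _ _).2 (Nat.lt_of_succ_lt ((hν _ _ _).1 h))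
  have hanti := height_antitone hν
  cases b
  · simp only [IsStrip, hle, true_and, hν, Bool.false_eq_true, false_imp_iff, true_imp_iff]
    refine forall₂_congr fun j a => ⟨fun h h1 h2 => ?_, fun h h1 => ?_⟩
    · have := h (by omega); omega
    · have := hanti j a
      by_contra h2
      exact h (by omega) (by omega)
  · simp only [IsStrip, hle, true_and, hν, Bool.true_eq_false, false_imp_iff, true_imp_iff,
      and_true]
    refine forall₂_congr fun j a => ⟨fun h h1 h2 => ?_, fun h h1 => ?_⟩
    · have := h (by omega); omega
    · have := hanti j a
      by_contra h2
      exact h (by omega) (by omega)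

namespace StripChain

variable {ε : ℕ → Bool} {M : ℕ} {μ : YoungDiagram}

theorem exists_notMem (ν : StripChain ε M μ) (p : ℕ × ℕ) : ∃ d, p ∉ ν.diag d :=
  ⟨M, by rw [ν.diag_eq_bot]; exact notMem_bot p⟩

open Classical in
/-- The number of diagrams of the chain which contain the cell `(j, a)`. -/
noncomputable def height (ν : StripChain ε M μ) (j a : ℕ) : ℕ := Nat.find (ν.exists_notMem (j, a))

theorem mem_diag_iff (ν : StripChain ε M μ) (d j a : ℕ) : (j, a) ∈ ν.diag d ↔ d < ν.height j a := by
  classical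
  rw [height, Nat.lt_find_iff]
  simp only [not_not]
  exact ⟨fun h i hi => ν.antitone hi h, fun h => h d le_rfl⟩

theorem height_le (ν : StripChain ε M μ) (j a : ℕ) : ν.height j a ≤ M := by
  by_contra! h
  exact notMem_bot (j, a) (ν.diag_eq_bot ▸ (ν.mem_diag_iff M j a).2 h)

theorem height_ne_zero_iff (ν : StripChain ε M μ) (j a : ℕ) : ν.height j a ≠ 0 ↔ (j, a) ∈ μ := by
  have h := ν.mem_diag_iff 0 j a
  rw [ν.diag_zero] at h
  rw [h, Nat.pos_iff_ne_zero]

/-- The chain of slices of a pile of boxes. -/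
noncomputable def ofHeight (F : ℕ → ℕ → ℕ) (hj : ∀ j a, F (j + 1) a ≤ F j a)
    (ha : ∀ j a, F j (a + 1) ≤ F j a) (hfin : {p : ℕ × ℕ | F p.1 p.2 ≠ 0}.Finite)
    (hμ : ∀ j a, (j, a) ∈ μ ↔ F j a ≠ 0)
    (hε : ∀ d, (ε d = true → ∀ j a, F j a = F j (a + 1) → F j a ≠ d + 1) ∧
      (ε d = false → ∀ j a, F j a = F (j + 1) a → F j a ≠ d + 1))
    (hM : ∀ j a, F j a ≤ M) : StripChain ε M μ where
  diag := slice F hj ha hfin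
  diag_zero := by
    ext ⟨j, a⟩
    rw [mem_cells, mem_cells, mem_slice, hμ, Nat.pos_iff_ne_zero]
  isStrip d := (isStrip_iff_of_height (ν := slice F hj ha hfin) (F := F)
    fun _ _ _ => mem_slice).2 (hε d)
  diag_eq_bot := by
    ext ⟨j, a⟩
    rw [mem_cells, mem_cells, mem_slice]
    simpa using hM j a

end StripChain

end YoungDiagram

/-! ### Plane `s`-partitions as pairs of strip chains. -/

namespace PlaneSPartition

variable {m n : ℕ} {s : ParitySequence m n} {k : ℤ}

/-- The conditions on the parts `A j a` and `B j a` of the layers of a plane `s`-partition. -/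
structure IsPartPair (s : ParitySequence m n) (k : ℤ) (A B : ℕ → ℕ → ℕ) : Prop where
  arm_part : ∀ j a, A (j + 1) a ≤ A j a
  arm_layer : ∀ j a, A j (a + 1) ≤ A j a
  leg_part : ∀ j a, B (j + 1) a ≤ B j a
  leg_layer : ∀ j a, B j (a + 1) ≤ B j a
  arm_part_eq : ∀ j a, A j a = A (j + 1) a → A j a ≠ 0 → s.sign (k + A j a) = s.sign k
  arm_layer_eq : ∀ j a, A j a = A j (a + 1) → A j a ≠ 0 → s.sign (k + A j a) = -s.sign k
  leg_part_eq : ∀ j a, B j a = B (j + 1) a → B j a ≠ 0 → s.sign (k - B j a) = s.sign k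
  leg_layer_eq : ∀ j a, B j a = B j (a + 1) → B j a ≠ 0 → s.sign (k - B j a) = -s.sign k
  arm_ne_zero : ∀ j a, B j a ≠ 0 → A j a ≠ 0
  leg_ne_zero : ∀ j a, A j (a + 1) ≠ 0 → B j a ≠ 0
  finite : {p : ℕ × ℕ | A p.1 p.2 ≠ 0}.Finite

theorem isPartPair (P : PlaneSPartition s k) :
    IsPartPair s k (fun j a => (P.layer a).arm j) (fun j a => (P.layer a).leg j) := by
  have hA : ∀ a j, j < (P.layer a).armLength ↔ (P.layer a).arm j ≠ 0 := fun a j =>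
    Finsupp.lt_card_support_iff (P.layer a).arm_anti
  have hB : ∀ a j, j < (P.layer a).legLength ↔ (P.layer a).leg j ≠ 0 := fun a j =>
    Finsupp.lt_card_support_iff (P.layer a).leg_anti
  refine ⟨fun j a => (P.layer a).arm_anti j, fun j a => ?_, fun j a => (P.layer a).leg_anti j,
    fun j a => ?_, fun j a h h0 => ?_, fun j a h h0 => ?_, fun j a h h0 => ?_, fun j a h h0 => ?_,
    fun j a h h0 => h ((P.layer a).leg_eq_zero j h0), fun j a h => ?_, ?_⟩
  · by_cases h : j < (P.layer (a + 1)).armLength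
    · exact (P.dominates a).arm_le j h
    · rw [hA, not_not] at h
      simp only [h, Nat.zero_le]
  · by_cases h : j < (P.layer (a + 1)).legLength
    · exact (P.dominates a).leg_le j h
    · rw [hB, not_not] at h
      simp only [h, Nat.zero_le]
  · exact ((P.layer a).arm_repeat j h).resolve_right fun h' => h0 h'.1
  · exact ((P.dominates a).arm_eq j ((hA _ _).2 (h ▸ h0)) h).resolve_right h0
  · exact ((P.layer a).leg_repeat j h).resolve_right fun h' => h0 h'.1
  · exact ((P.dominates a).leg_eq j ((hB _ _).2 (h ▸ h0)) h).resolve_right h0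
  · exact (hB _ _).1 (((hA _ _).2 h).trans_le (P.dominates a).length_arm_leg)
  · refine (Set.Finite.biUnion P.finite fun a _ =>
      ((P.layer a).arm.support.finite_toSet.image fun j => (j, a))).subset ?_
    rintro ⟨j, a⟩ h
    refine Set.mem_biUnion (x := a) (fun h' => h ?_) ⟨j, by simpa using h, rfl⟩
    simp [h'.1]

/-- The plane `s`-partition with prescribed parts. -/
noncomputable def ofParts {A B : ℕ → ℕ → ℕ} (h : IsPartPair s k A B) : PlaneSPartition s k where
  layer a :=
    { arm := Finsupp.ofSupportFinite (fun j => A j a)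
        ((h.finite.image Prod.fst).subset fun j hj => ⟨(j, a), hj, rfl⟩)
      leg := Finsupp.ofSupportFinite (fun j => B j a)
        ((h.finite.image Prod.fst).subset fun j hj => ⟨(j, a), h.arm_ne_zero j a hj, rfl⟩)
      arm_anti := fun j => h.arm_part j a
      arm_repeat := fun j hj => by
        -- A zero part meets the sign condition trivially, because `k + 0 = k`. The exceptional
        -- alternatives for zero parts are therefore never needed.
        by_cases h0 : A j a = 0
        · left
          simp [Finsupp.ofSupportFinite_coe, h0]
        · exact Or.inl (h.arm_part_eq j a hj h0)
      leg_anti := fun j => h.leg_part j a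
      leg_repeat := fun j hj => by
        by_cases h0 : B j a = 0
        · left
          simp [Finsupp.ofSupportFinite_coe, h0]
        · exact Or.inl (h.leg_part_eq j a hj h0)
      leg_eq_zero := fun j hj => by
        by_contra h0
        exact h.arm_ne_zero j a h0 hj }
  dominates a := by
    have hA : ∀ a j, j < (Finsupp.ofSupportFinite (fun j => A j a)
        ((h.finite.image Prod.fst).subset fun j hj => ⟨(j, a), hj, rfl⟩)).support.card ↔
        A j a ≠ 0 := fun a j => Finsupp.lt_card_support_iff fun j => h.arm_part j a
    have hB : ∀ a j, j < (Finsupp.ofSupportFinite (fun j => B j a)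
        ((h.finite.image Prod.fst).subset fun j hj =>
          ⟨(j, a), h.arm_ne_zero j a hj, rfl⟩)).support.card ↔
        B j a ≠ 0 := fun a j => Finsupp.lt_card_support_iff fun j => h.leg_part j a
    refine ⟨?_, ?_, ?_, fun i _ => h.arm_layer i a, fun i hi hi' => ?_, fun i _ => h.leg_layer i a,
      fun i hi hi' => ?_⟩
    · refine le_of_not_gt fun hlt => ?_
      exact lt_irrefl _ ((hB a _).2 (h.leg_ne_zero _ a ((hA (a + 1) _).1 hlt)))
    · refine le_of_not_gt fun hlt => ?_
      have h1 := (hA (a + 1) _).1 hlt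
      exact lt_irrefl _ ((hA a _).2 (h.arm_ne_zero _ a (h.leg_ne_zero _ a h1)))
    · refine le_of_not_gt fun hlt => ?_
      have h1 := h.arm_ne_zero _ _ ((hB (a + 1) _).1 hlt)
      exact lt_irrefl _ ((hB a _).2 (h.leg_ne_zero _ a h1))
    · left
      exact h.arm_layer_eq i a hi' fun h0 => (hA (a + 1) i).1 hi (hi'.symm.trans h0)
    · left
      exact h.leg_layer_eq i a hi' fun h0 => (hB (a + 1) i).1 hi (hi'.symm.trans h0)
  finite := by
    refine (h.finite.image Prod.snd).subset fun a ha => ?_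
    by_contra hne
    have h0 : ∀ j, A j a = 0 := fun j => by
      by_contra hj
      exact hne ⟨(j, a), hj, rfl⟩
    refine ha ⟨Finsupp.ext fun j => h0 j, Finsupp.ext fun j => ?_⟩
    by_contra hj
    exact h.arm_ne_zero j a hj (h0 j)

/-- The type of the `i`-th strip to the left of the main diagonal slice. -/
def leftType (s : ParitySequence m n) (k : ℤ) (i : ℕ) : Bool := s.sign (k - i) = s.sign k

/-- The type of the `i`-th strip to the right of the main diagonal slice. -/
def rightType (s : ParitySequence m n) (k : ℤ) (i : ℕ) : Bool :=
  s.sign (k + (i + 1 : ℕ)) = s.sign k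

variable (s k) in
/-- Plane `s`-partitions all of whose boxes have `-M ≤ i - j ≤ M + 1` correspond to pairs of strip
chains with the same initial diagram, the main diagonal slice. -/
noncomputable def equivStripChains (M : ℕ) :
    {P : PlaneSPartition s k // ∀ j a, (P.layer a).arm j ≤ M + 1 ∧ (P.layer a).leg j ≤ M} ≃
      Σ μ, YoungDiagram.StripChain (leftType s k) (M + 1) μ ×
        YoungDiagram.StripChain (rightType s k) (M + 1) μ where
  toFun P :=
    have h := P.1.isPartPair
    ⟨YoungDiagram.slice (fun j a => (P.1.layer a).arm j) h.arm_part h.arm_layer h.finite 0,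
      YoungDiagram.StripChain.ofHeight
        -- The shift by one makes the main slice, given by the nonzero arms, the first diagram of
        -- the left chain too. Slice `d + 1` then consists of the cells with leg greater than `d`.
        (fun j a => if (P.1.layer a).arm j = 0 then 0 else (P.1.layer a).leg j + 1)
        (fun j a => by
          have := h.arm_part j a; have := h.leg_part j a
          split_ifs <;> omega)
        (fun j a => by
          have := h.arm_layer j a; have := h.leg_layer j a
          split_ifs <;> omega)
        (h.finite.subset fun p hp => by
          simp only [Set.mem_ofPred_eq] at hp ⊢
          intro h0
          simp [h0] at hp)
        (fun j a => by rw [YoungDiagram.mem_slice]; split_ifs <;> omega)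
        (fun d => ⟨fun hd j a => by
            have h1 := h.leg_layer_eq j a
            have h2 := h.leg_ne_zero j a
            have h3 := h.arm_layer j a
            simp only [leftType, decide_eq_true_eq] at hd
            intro he hF
            have hA : (P.1.layer a).arm j ≠ 0 := by
              intro h0; simp [h0] at hF
            have hA' : (P.1.layer (a + 1)).arm j ≠ 0 := by
              intro h0; simp [h0, hA] at he
            rw [if_neg hA] at hF he
            rw [if_neg hA'] at he
            have h4 := h1 (by omega) (h2 hA')
            -- This covers `d = 0` as well: there `leg_ne_zero` has made the leg nonzero, since the
            -- next layer has a nonzero arm at `j`.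
            have : (P.1.layer a).leg j = d := by omega
            rw [this, hd] at h4
            exact units_ne_neg_self _ h4,
          fun hd j a => by
            have h1 := h.leg_part_eq j a
            simp only [leftType, decide_eq_false_iff_not] at hd
            intro he hF
            have hA : (P.1.layer a).arm j ≠ 0 := by
              intro h0; simp [h0] at hF
            have hA' : (P.1.layer a).arm (j + 1) ≠ 0 := by
              intro h0; simp [h0, hA] at he
            rw [if_neg hA] at hF he
            rw [if_neg hA'] at he
            have hd' : (P.1.layer a).leg j = d := by omega
            rw [hd'] at h1
            refine hd (h1 (by omega) ?_)
            -- For `d = 0` the strip is always vertical, so this case is excluded by the type.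
            rintro rfl
            simp at hd⟩)
        (fun j a => by
          have := (P.2 j a).2
          split_ifs <;> omega),
      YoungDiagram.StripChain.ofHeight (fun j a => (P.1.layer a).arm j) h.arm_part h.arm_layer
        h.finite (fun j a => by rw [YoungDiagram.mem_slice, Nat.pos_iff_ne_zero])
        (fun d => ⟨fun hd j a he hF => by
            have h1 := h.arm_layer_eq j a he (by simp only [hF]; omega)
            simp only [rightType, decide_eq_true_eq] at hd
            simp only [hF] at h1
            rw [hd] at h1
            exact units_ne_neg_self _ h1,
          fun hd j a he hF => by
            have h1 := h.arm_part_eq j a he (by simp only [hF]; omega)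
            simp only [rightType, decide_eq_false_iff_not] at hd
            simp only [hF] at h1
            exact hd h1⟩)
        (fun j a => (P.2 j a).1)⟩
  invFun c :=
    ⟨ofParts (A := c.2.2.height) (B := fun j a => c.2.1.height j a - 1) (by
      have hl := YoungDiagram.height_antitone c.2.1.mem_diag_iff
      have hr := YoungDiagram.height_antitone c.2.2.mem_diag_iff
      have hl' := fun d => (YoungDiagram.isStrip_iff_of_height c.2.1.mem_diag_iff).1
        (c.2.1.isStrip d)
      have hr' := fun d => (YoungDiagram.isStrip_iff_of_height c.2.2.mem_diag_iff).1
        (c.2.2.isStrip d)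
      have h0 : ∀ j a, c.2.1.height j a ≠ 0 ↔ c.2.2.height j a ≠ 0 := fun j a => by
        rw [c.2.1.height_ne_zero_iff, c.2.2.height_ne_zero_iff]
      refine ⟨fun j a => (hr j a).1, fun j a => (hr j a).2,
        fun j a => Nat.sub_le_sub_right (hl j a).1 1, fun j a => Nat.sub_le_sub_right (hl j a).2 1,
        fun j a he hA => ?_, fun j a he hA => ?_, fun j a he hB => ?_, fun j a he hB => ?_,
        fun j a hB => (h0 j a).1 (by omega), fun j a hA => ?_, ?_⟩
      · obtain ⟨d, hd⟩ := Nat.exists_eq_succ_of_ne_zero hA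
        by_contra hs
        exact (hr' d).2 (by rw [rightType, decide_eq_false_iff_not, ← Nat.succ_eq_add_one, ← hd];
                            exact hs) j a he hd
      · obtain ⟨d, hd⟩ := Nat.exists_eq_succ_of_ne_zero hA
        rw [← Int.units_ne_iff_eq_neg]
        intro hs
        exact (hr' d).1 (by rw [rightType, decide_eq_true_eq, ← Nat.succ_eq_add_one, ← hd];
                            exact hs) j a he hd
      · by_contra hs
        exact (hl' (c.2.1.height j a - 1)).2 (by rw [leftType, decide_eq_false_iff_not]; exact hs)
          j a (by omega) (by omega)
      · rw [← Int.units_ne_iff_eq_neg]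
        intro hs
        exact (hl' (c.2.1.height j a - 1)).1 (by rw [leftType, decide_eq_true_eq]; exact hs)
          j a (by omega) (by omega)
      -- The step from the main slice to the first left slice is a vertical strip. This is exactly
      -- the requirement that a nonzero arm in the next layer lies over a nonzero leg.
      · intro hB
        have h1 := (h0 j (a + 1)).2 hA
        have h2 := (hl j a).2
        exact (hl' 0).1 (by simp [leftType]) j a (by omega) (by omega)
      · refine c.1.cells.finite_toSet.subset ?_
        rintro ⟨j, a⟩ h
        exact (c.2.2.height_ne_zero_iff j a).1 h),
    fun j a => ⟨c.2.2.height_le j a, Nat.sub_le_of_le_add (c.2.1.height_le j a)⟩⟩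
  left_inv := by
    rintro ⟨P, hP⟩
    refine Subtype.ext (PlaneSPartition.ext (funext fun a => SPartition.ext ?_ ?_))
    · refine Finsupp.ext fun j => eq_of_forall_lt_iff fun d => ?_
      exact (YoungDiagram.StripChain.mem_diag_iff _ d j a).symm.trans YoungDiagram.mem_slice
    · refine Finsupp.ext fun j => eq_of_forall_lt_iff fun d => ?_
      refine (Nat.lt_sub_iff_add_lt.trans
        ((YoungDiagram.StripChain.mem_diag_iff _ (d + 1) j a).symm.trans
        YoungDiagram.mem_slice)).trans ?_
      have := (P.layer a).leg_eq_zero j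
      split_ifs with h0
      · simp [this h0]
      · simp
  right_inv := by
    have key : ∀ c c' : Σ μ, YoungDiagram.StripChain (leftType s k) (M + 1) μ ×
        YoungDiagram.StripChain (rightType s k) (M + 1) μ,
        (∀ j a d, (j, a) ∈ c.2.1.diag d ↔ (j, a) ∈ c'.2.1.diag d) →
        (∀ j a d, (j, a) ∈ c.2.2.diag d ↔ (j, a) ∈ c'.2.2.diag d) → c = c' := by
      rintro ⟨μ, t, u⟩ ⟨μ', t', u'⟩ h h'
      have ht : t.diag = t'.diag := by
        funext d; ext ⟨j, a⟩; exact h j a d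
      have hu : u.diag = u'.diag := by
        funext d; ext ⟨j, a⟩; exact h' j a d
      obtain rfl : μ = μ' := by rw [← t.diag_zero, ← t'.diag_zero, ht]
      rw [YoungDiagram.StripChain.ext ht, YoungDiagram.StripChain.ext hu]
    intro c
    refine key _ _ (fun j a d => ?_) fun j a d => ?_
    · refine YoungDiagram.mem_slice.trans (Iff.trans ?_ (c.2.1.mem_diag_iff d j a).symm)
      have h0 : c.2.1.height j a ≠ 0 ↔ c.2.2.height j a ≠ 0 := by
        rw [c.2.1.height_ne_zero_iff, c.2.2.height_ne_zero_iff]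
      change d < (if c.2.2.height j a = 0 then 0 else c.2.1.height j a - 1 + 1) ↔ _
      split_ifs <;> omega
    · exact YoungDiagram.mem_slice.trans (c.2.2.mem_diag_iff d j a).symm

end PlaneSPartition

/-! ### The degree in terms of the slices. -/

namespace YoungDiagram

variable {σ : Type*}

/-- Abel summation: boxes are counted row by row on the left, with a correction for rows going
beyond `M`, and slice by slice on the right. -/
theorem chainWeight_sum_range (u : ℕ → σ →₀ ℕ) {ν : ℕ → YoungDiagram} (hν : Antitone ν) (M : ℕ) :
    chainWeight (fun i => ∑ t ∈ Finset.range (i + 1), u t) M ν +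
      (ν M).card • ∑ t ∈ Finset.range M, u t = ∑ i ∈ Finset.range M, (ν i).card • u i := by
  induction M with
  | zero => simp [chainWeight]
  | succ M ih =>
    rw [Finset.sum_range_succ (fun i => (ν i).card • u i), ← ih, chainWeight, chainWeight,
      Finset.sum_range_succ, add_assoc, ← add_smul,
      Nat.sub_add_cancel (card_mono (hν (Nat.le_succ M))), Finset.sum_range_succ u, smul_add,
      ← add_assoc]

end YoungDiagram

namespace PlaneSPartition

variable {m n : ℕ} {s : ParitySequence m n} {k : ℤ}

/-- The slices of a plane `s`-partition determined by the chains of diagrams. -/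
theorem mem_diag_equivStripChains {M : ℕ}
    (P : {P : PlaneSPartition s k // ∀ j a, (P.layer a).arm j ≤ M + 1 ∧ (P.layer a).leg j ≤ M})
    (d j a : ℕ) :
    ((j, a) ∈ (equivStripChains s k M P).2.1.diag (d + 1) ↔ d < (P.1.layer a).leg j) ∧
      ((j, a) ∈ (equivStripChains s k M P).2.2.diag d ↔ d < (P.1.layer a).arm j) := by
  refine ⟨YoungDiagram.mem_slice.trans ?_, YoungDiagram.mem_slice⟩
  have := (P.1.layer a).leg_eq_zero j
  split_ifs with h0
  · simp [this h0]
  · simp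

/-- Colour depends only on `i - j`. A box with `i - j = d ≥ 0` is a cell of right slice `d`, and one
with `j - i = d + 1` is a cell of left slice `d + 1`; the main diagonal is counted on the right
only. -/
theorem degree_eq_sum [NeZero (m + n)] {M : ℕ}
    (P : {P : PlaneSPartition s k // ∀ j a, (P.layer a).arm j ≤ M + 1 ∧ (P.layer a).leg j ≤ M}) :
    P.1.degree =
      ∑ i ∈ Finset.range M, ((equivStripChains s k M P).2.1.diag (i + 1)).card •
        Finsupp.single ((k - 1 - i : ℤ) : ZMod (m + n)) 1 +
      ∑ i ∈ Finset.range (M + 1), ((equivStripChains s k M P).2.2.diag i).card •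
        Finsupp.single ((k + i : ℤ) : ZMod (m + n)) 1 := by
  classical
  have hmem := mem_diag_equivStripChains P
  set L := (equivStripChains s k M P).2.1.diag
  set R := (equivStripChains s k M P).2.2.diag
  ext c
  let f : (Σ _ : ℕ, ℕ × ℕ) → ℕ × ℕ × ℕ := fun p => (p.2.1, p.2.1 + 1 + p.1, p.2.2)
  let g : (Σ _ : ℕ, ℕ × ℕ) → ℕ × ℕ × ℕ := fun p => (p.2.1 + p.1, p.2.1, p.2.2)
  have hf : Function.Injective f := by
    rintro ⟨i, j, a⟩ ⟨i', j', a'⟩ h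
    simp only [f, Prod.mk.injEq] at h
    obtain ⟨rfl, h, rfl⟩ := h
    obtain rfl : i = i' := by omega
    rfl
  have hg : Function.Injective g := by
    rintro ⟨i, j, a⟩ ⟨i', j', a'⟩ h
    simp only [g, Prod.mk.injEq] at h
    obtain ⟨h, rfl, rfl⟩ := h
    obtain rfl : i = i' := by omega
    rfl
  let S := ((Finset.range M).filter fun i : ℕ => ((k - 1 - i : ℤ) : ZMod (m + n)) = c).sigma
    fun i => (L (i + 1)).cells
  let T := ((Finset.range (M + 1)).filter fun i : ℕ => ((k + i : ℤ) : ZMod (m + n)) = c).sigma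
    fun i => (R i).cells
  have hset : {b ∈ P.1.boxes | color m n k b = c} = ((S.image f ∪ T.image g : Finset _) : Set _) := by
    ext ⟨i, j, a⟩
    simp only [boxes, color, Set.mem_ofPred_eq, Finset.coe_union, Finset.coe_image, Set.mem_union,
      Set.mem_image, Finset.mem_coe, S, T, Finset.mem_sigma, Finset.mem_filter, Finset.mem_range,
      YoungDiagram.mem_cells, Sigma.exists, Prod.exists, f, g, Prod.mk.injEq, (hmem _ _ _).1,
      (hmem _ _ _).2]
    constructor
    · rintro ⟨⟨h1, h2⟩ | ⟨h1, h2⟩, h3⟩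
      · refine Or.inr ⟨i - j, j, a, ⟨⟨?_, ?_⟩, by omega⟩, by omega, rfl, rfl⟩
        · have := (P.2 j a).1
          omega
        · rw [← h3, Nat.cast_sub h1]
          congr 1
          ring
      · refine Or.inl ⟨j - (i + 1), i, a, ⟨⟨?_, ?_⟩, by omega⟩, rfl, by omega, rfl⟩
        · have := (P.2 i a).2
          omega
        · rw [← h3, Nat.cast_sub h1]
          congr 1
          push_cast
          ring
    · rintro (⟨d, i', a', ⟨⟨h1, h2⟩, h3⟩, rfl, rfl, rfl⟩ | ⟨d, j', a', ⟨⟨h1, h2⟩, h3⟩, rfl, rfl, rfl⟩)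
      · refine ⟨Or.inr ⟨by omega, by omega⟩, ?_⟩
        rw [← h2]
        congr 1
        push_cast
        ring
      · refine ⟨Or.inl ⟨by omega, by omega⟩, ?_⟩
        rw [← h2]
        congr 1
        push_cast
        ring
  have hdisj : Disjoint (S.image f) (T.image g) := by
    rw [Finset.disjoint_left]
    rintro _ h h'
    obtain ⟨p, _, rfl⟩ := Finset.mem_image.1 h
    obtain ⟨q, _, hq⟩ := Finset.mem_image.1 h'
    simp only [f, g, Prod.mk.injEq] at hq
    omega
  change {b ∈ P.1.boxes | color m n k b = c}.ncard = _
  rw [hset, Set.ncard_coe_finset, Finset.card_union_of_disjoint hdisj,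
    Finset.card_image_of_injective _ hf, Finset.card_image_of_injective _ hg, Finset.card_sigma,
    Finset.card_sigma, Finset.sum_filter, Finset.sum_filter, Finsupp.add_apply,
    Finsupp.finsetSum_apply, Finsupp.finsetSum_apply]
  simp [Finsupp.single_apply, YoungDiagram.card]

theorem degree_eq_chainWeight [NeZero (m + n)] {M : ℕ}
    (P : {P : PlaneSPartition s k // ∀ j a, (P.layer a).arm j ≤ M + 1 ∧ (P.layer a).leg j ≤ M}) :
    P.1.degree =
      YoungDiagram.chainWeight (leftExponent m n k) (M + 1) (equivStripChains s k M P).2.1.diag +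
      YoungDiagram.chainWeight (rightExponent m n k) (M + 1) (equivStripChains s k M P).2.2.diag := by
  have hL := YoungDiagram.chainWeight_sum_range
    (fun t => Finsupp.single ((k - 1 - t : ℤ) : ZMod (m + n)) 1)
    (ν := fun i => (equivStripChains s k M P).2.1.diag (i + 1))
    (fun i j hij => (equivStripChains s k M P).2.1.antitone (Nat.succ_le_succ hij)) M
  have hR := YoungDiagram.chainWeight_sum_range
    (fun t => Finsupp.single ((k + t : ℤ) : ZMod (m + n)) 1)
    (equivStripChains s k M P).2.2.antitone (M + 1)
  simp only [(equivStripChains s k M P).2.1.diag_eq_bot,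
    (equivStripChains s k M P).2.2.diag_eq_bot] at hL hR
  have h0 : (⊥ : YoungDiagram).card = 0 := rfl
  rw [h0, zero_smul, add_zero] at hL hR
  rw [degree_eq_sum, ← hL, ← hR, YoungDiagram.chainWeight_succ (leftExponent m n k)]
  -- The step from the main slice to the first left slice carries no weight: the main diagonal is
  -- already counted on the right.
  have hx : leftExponent m n k 0 = 0 := rfl
  rw [hx, smul_zero, zero_add]
  rfl

/-! ### Finiteness in each degree and the infinite product. -/

theorem hasGeneratingFunction_degree [NeZero (m + n)] (s : ParitySequence m n) (k : ℤ) (M : ℕ) :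
    HasGeneratingFunction
      (fun P : {P : PlaneSPartition s k //
        ∀ j a, (P.layer a).arm j ≤ M + 1 ∧ (P.layer a).leg j ≤ M} => P.1.degree)
      (∏ i ∈ Finset.range (M + 1), ∏ j ∈ Finset.range (M + 1), rootFactor s (k - i) (k + j)) := by
  have h := YoungDiagram.hasGeneratingFunction_stripChain_pair (rightType s k) (M + 1)
    (rightExponent m n k) (M + 1) (leftType s k) (leftExponent m n k) fun i j h0 => by
      have := degree_leftExponent_add_rightExponent m n k i j
      rw [h0, map_zero] at this
      omega
  simp only [rootFactor_eq_stripFactor]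
  exact h.congr ⟨equivStripChains s k M, fun P => (degree_eq_chainWeight P).symm⟩

theorem exists_bound (P : PlaneSPartition s k) :
    ∃ M, ∀ j a, (P.layer a).arm j ≤ M + 1 ∧ (P.layer a).leg j ≤ M := by
  have h := P.isPartPair
  obtain ⟨M, hM⟩ := (h.finite.image fun p => (P.layer p.2).arm p.1).bddAbove
  obtain ⟨M', hM'⟩ := (h.finite.image fun p => (P.layer p.2).leg p.1).bddAbove
  refine ⟨M + M', fun j a => ?_⟩
  by_cases h0 : (P.layer a).arm j = 0
  · rw [h0, (P.layer a).leg_eq_zero j h0]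
    omega
  · have h1 : (P.layer a).arm j ≤ M := hM ⟨(j, a), h0, rfl⟩
    have h2 : (P.layer a).leg j ≤ M' := hM' ⟨(j, a), h0, rfl⟩
    omega

/-- A part of size `r` meets `r` slices, each of which then has at least one cell. Hence every `P`
of degree `l` already satisfies the truncation bound with `M = l.degree`. -/
theorem arm_le_degree_and_leg_le_degree [NeZero (m + n)] (P : PlaneSPartition s k) (j a : ℕ) :
    (P.layer a).arm j ≤ P.degree.degree ∧ (P.layer a).leg j ≤ P.degree.degree := by
  obtain ⟨M, hM⟩ := P.exists_bound
  have hdeg := degree_eq_sum ⟨P, hM⟩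
  have hmem := mem_diag_equivStripChains ⟨P, hM⟩
  simp only at hdeg hmem
  rw [hdeg]
  simp only [map_add, map_sum, map_nsmul, Finsupp.degree_single, smul_eq_mul, mul_one]
  constructor
  · refine le_trans ?_ (Nat.le_add_left _ _)
    calc (P.layer a).arm j = ∑ i ∈ Finset.range ((P.layer a).arm j), 1 := by simp
      _ ≤ ∑ i ∈ Finset.range ((P.layer a).arm j),
          ((equivStripChains s k M ⟨P, hM⟩).2.2.diag i).card :=
        Finset.sum_le_sum fun i hi => Finset.card_pos.2
          ⟨(j, a), (hmem i j a).2.2 (Finset.mem_range.1 hi)⟩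
      _ ≤ _ := Finset.sum_le_sum_of_subset (Finset.range_mono (hM j a).1)
  · refine le_trans ?_ (Nat.le_add_right _ _)
    calc (P.layer a).leg j = ∑ i ∈ Finset.range ((P.layer a).leg j), 1 := by simp
      _ ≤ ∑ i ∈ Finset.range ((P.layer a).leg j),
          ((equivStripChains s k M ⟨P, hM⟩).2.1.diag (i + 1)).card :=
        Finset.sum_le_sum fun i hi => Finset.card_pos.2
          ⟨(j, a), (hmem i j a).1.2 (Finset.mem_range.1 hi)⟩
      _ ≤ _ := Finset.sum_le_sum_of_subset (Finset.range_mono (hM j a).2)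

theorem finite_degree_and_ncard [NeZero (m + n)] (s : ParitySequence m n) (k : ℤ)
    (l : ZMod (m + n) →₀ ℕ) :
    {P : PlaneSPartition s k | P.degree = l}.Finite ∧
      ({P : PlaneSPartition s k | P.degree = l}.ncard : ℤ) =
        MvPowerSeries.coeff l (∏ i ∈ Finset.range (l.degree + 1),
          ∏ j ∈ Finset.range (l.degree + 1), rootFactor s (k - i) (k + j)) := by
  obtain ⟨h1, h2⟩ := hasGeneratingFunction_degree s k l.degree l
  have himage : {P : PlaneSPartition s k | P.degree = l} = Subtype.val ''
      {P : {P : PlaneSPartition s k // ∀ j a, (P.layer a).arm j ≤ l.degree + 1 ∧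
        (P.layer a).leg j ≤ l.degree} | P.1.degree = l} := by
    ext P
    constructor
    · rintro rfl
      exact ⟨⟨P, fun j a => ⟨(P.arm_le_degree_and_leg_le_degree j a).1.trans (Nat.le_succ _),
        (P.arm_le_degree_and_leg_le_degree j a).2⟩⟩, rfl, rfl⟩
    · rintro ⟨P, hP, rfl⟩
      exact hP
  rw [himage]
  exact ⟨h1.image _, by rw [Set.ncard_image_of_injective _ Subtype.val_injective, h2]⟩

theorem hasProd_rootFactor [NeZero (m + n)] (s : ParitySequence m n) (k : ℤ) :
    HasProd (fun p : Set.Iic k × Set.Ici k => rootFactor s (p.1 : ℤ) (p.2 : ℤ))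
      (generatingFunction s k) := by
  classical
  let φ : ℕ × ℕ → Set.Iic k × Set.Ici k := fun p =>
    (⟨k - p.1, by simp⟩, ⟨k + p.2, by simp⟩)
  have hφ : Function.Injective φ := by
    rintro ⟨i, j⟩ ⟨i', j'⟩ h
    simpa [φ] using h
  have hφ' : Function.Surjective φ := by
    rintro ⟨⟨i, hi⟩, ⟨j, hj⟩⟩
    simp only [Set.mem_Iic, Set.mem_Ici] at hi hj
    refine ⟨((k - i).toNat, (j - k).toNat), ?_⟩
    simp only [φ, Prod.mk.injEq, Subtype.mk.injEq]
    omega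
  refine MvPowerSeries.hasProd_of_coeff fun l => ⟨((Finset.range (l.degree + 1)) ×ˢ
    (Finset.range (l.degree + 1))).image φ, ?_, fun p hp l' hl' => ?_⟩
  · rw [Finset.prod_image hφ.injOn, Finset.prod_product]
    exact (finite_degree_and_ncard s k l).2
  · obtain ⟨⟨i, j⟩, rfl⟩ := hφ' p
    -- Outside the square, `i` or `j` exceeds `l.degree`, so the monomial, of degree `i + j + 1`, is
    -- too large to affect the coefficient.
    have hij : ¬ (i < l.degree + 1 ∧ j < l.degree + 1) := fun h => hp <|
      Finset.mem_image_of_mem _ <| by simpa only [Finset.mem_product, Finset.mem_range] using h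
    simp only [φ, rootFactor_eq_stripFactor]
    refine coeff_stripFactor_of_degree_lt _ _ ?_
    rw [degree_leftExponent_add_rightExponent]
    omega

end PlaneSPartition

/-! ### Dimensions of the graded components and the character. -/

theorem MacMahonModule.component_eq_supported {m n : ℕ} [NeZero (m + n)] (s : ParitySequence m n)
    (k : ℤ) (l : ZMod (m + n) →₀ ℕ) :
    MacMahonModule.component s k l =
      Finsupp.supported ℂ ℂ {P : PlaneSPartition s k | P.degree = l} :=
  (Finsupp.supported_eq_span_single ℂ _).symm

theorem MacMahonModule.finrank_component {m n : ℕ} [NeZero (m + n)] (s : ParitySequence m n)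
    (k : ℤ) (l : ZMod (m + n) →₀ ℕ) :
    Module.finrank ℂ (MacMahonModule.component s k l) =
      {P : PlaneSPartition s k | P.degree = l}.ncard := by
  have := (PlaneSPartition.finite_degree_and_ncard s k l).1.fintype
  rw [component_eq_supported, (Finsupp.supportedEquivFinsupp _).finrank_eq,
    Module.finrank_finsupp_self, Set.ncard_eq_toFinset_card', Set.toFinset_card]

theorem theorem7p6 (m n : ℕ) [NeZero (m + n)] (s : ParitySequence m n) (k : ℤ) :
    (∀ l : ZMod (m + n) →₀ ℕ,
      FiniteDimensional ℂ (MacMahonModule.component s k l) ∧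
      {P : PlaneSPartition s k | P.degree = l}.Finite) ∧
    gradedCharacter (MacMahonModule.component s k) = PlaneSPartition.generatingFunction s k ∧
    HasProd (fun p : Set.Iic k × Set.Ici k => rootFactor s (p.1 : ℤ) (p.2 : ℤ))
      (gradedCharacter (MacMahonModule.component s k)) := by
  have hchar : gradedCharacter (MacMahonModule.component s k) =
      PlaneSPartition.generatingFunction s k :=
    funext fun l => congrArg Nat.cast (MacMahonModule.finrank_component s k l)
  refine ⟨fun l => ?_, hchar, hchar ▸ PlaneSPartition.hasProd_rootFactor s k⟩
  have hfin := (PlaneSPartition.finite_degree_and_ncard s k l).1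
  exact ⟨FiniteDimensional.span_of_finite ℂ (hfin.image _), hfin⟩
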